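/- **Setting.** Fix countably infinite sets of symbolic constants and of program variables, the latter linearly ordered. *Ground terms* are the numerals $\overline n$ ($n\in\mathbb Z$), the symbolic constants, and the symbols $\mathit{inf},\mathit{sup}$; they carry a total order in which $\mathit{inf}$ is least, $\mathit{sup}$ is greatest, $\overline m<\overline n$ iff $m<n$, and $\overline n<c$ for every symbolic constant $c$. *Program terms* are ground terms and variables. An *atomic formula* is an atom $p(t_1,\dots,t_n)$ ($p$ a symbolic constant, $t_i$ program terms) or a comparison $t\prec t'$ with $\prec\in\{=,\neq,<,>,\le,\ge\}$; a *basic literal* is an atomic formula preceded by zero, one or two occurrences of $\mathit{not}$. An *aggregate element* $E$ is $t_1,\dots,t_k:l_1,\dots,l_m$ ($t_i$ program terms, $l_j$ basic literals); an *aggregate atom* is $\#\mathrm{op}\{E\}\prec u$ with $\mathrm{op}\in\{\mathrm{count},\mathrm{sum}\}$ and $u$ a program term (the guard); an *aggregate literal* is an aggregate atom preceded by zero, one or two occurrences of $\mathit{not}$. A *rule* is $\mathit{Head}\leftarrow B_1,\dots,B_n$, where $\mathit{Head}$ is an atom or $\bot$ and each $B_i$ is a basic or aggregate literal. A *program* is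 a (possibly infinite) set of rules. A variable is *global* in a rule if it occurs in the head, in a basic literal of the body, or in a guard. For a set $T$ of tuples of ground terms, $\widehat{\mathrm{count}}(T)$ is the numeral of $|T|$ if $T$ is finite and $\mathit{sup}$ otherwise; $\widehat{\mathrm{sum}}(T)$ is the numeral of the sum of the weights of the tuples in $T$ if only finitely many have non-zero weight and $\overline 0$ otherwise, where the weight of a tuple is $n$ if its first member is $\overline n$, and $0$ if it has no such first member. A *set symbol* $E/\mathbf X$ is an aggregate element with a list $\mathbf X$ of distinct variables of $E$; it *occurs* in a rule if the rule has an aggregate literal with element $E$ and $\mathbf X$ is the ordered list of the variables of $E$ global in the rule. A predicate symbol $p/n$ occurs in a program if some atom $p(t_1,\dots,t_n)$ occurs in it, possibly inside an aggregate. **Signature and here-and-there logic.** Let $\mathcal P,\mathcal S$ be sets of predicate symbols and of set symbols, $\mathcal P$ containing the predicate symbols that occur in the elements $E$ of the set symbols $E/\mathbf X\in\mathcal S$. The signature $\sigma(\mathcal P,\mathcal S)$ has a general, a tuple and a set sort; the ground terms as general constants; the symbols of $\mathcal P$ on the general sort; the comparisons $\neq,<,>,\le,\ge$; membership $\in$;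 the constructor of $k$-tuples for each length $k$ of the term list of an $E$ with $E/\mathbf X\in\mathcal S$; functions $\mathrm{count},\mathrm{sum}$ from the set to the general sort; and for each $E/\mathbf X\in\mathcal S$ functions $s^{cli}_{E/\mathbf X},s^{dlv}_{E/\mathbf X}$ from $|\mathbf X|$ general arguments to the set sort. The symbols of $\mathcal P$ and the functions $s^{x}_{E/\mathbf X}$ are intensional. Formulas are first-order formulas with equality and an extra unary connective $\sim$, with $I\models\;\sim F$ iff $I\not\models F$; $\neg F$ is $F\to\bot$. An *ht-interpretation* is a pair $\langle H,I\rangle$ of interpretations with the same universes, with $p^H\subseteq p^I$ for intensional $p$ and agreeing on all non-intensional symbols. It satisfies an atomic formula (equalities included) iff both $H$ and $I$ do; $\sim F$ iff $I\not\models F$ and $H\not\models F$; $F\to G$ iff $I\models F\to G$ and ($\langle H,I\rangle\not\models F$ or $\langle H,I\rangle\models G$); $\bot,\wedge,\vee,\forall,\exists$ are treated as usual. An interpretation is *standard* if its general universe is the set of ground terms; its tuple universe is the set of tuples of ground terms of the lengths $k$ above; its set universe consists of subsets of the tuple universe; and ground terms, comparisons (including $\neq$), tuple constructors, $\in$, $\mathrm{count}$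 and $\mathrm{sum}$ have their intended meaning. The translation $\tau^{cli}$ leaves atomic formulas unchanged, maps $\#\mathrm{op}\{E\}\prec u$ in a rule to $\mathrm{op}(s^{cli}_{E/\mathbf X}(\mathbf X))\prec u$ with $\mathbf X$ the ordered list of the variables of $E$ global in the rule, replaces $\mathit{not}$ by $\neg$, and maps a rule to the universal closure of $\tau^{cli}B_1\wedge\dots\wedge\tau^{cli}B_n\to\mathit{Head}$; $\tau^{dlv}$ is the same with $s^{dlv}$ for $s^{cli}$ and $\sim$ for $\neg$. A program is translated rule by rule. An *agg-ht-interpretation* is an ht-interpretation $\langle H,I\rangle$ with $H,I$ standard such that, for all $E/\mathbf X\in\mathcal S$ with $E=t_1,\dots,t_k:l_1,\dots,l_m$, all tuples $\mathbf x$ of ground terms, and $\mathbf Y$ the list of the variables of $E$ not in $\mathbf X$, the sets $s^{x}_{E/\mathbf X}(\mathbf x)^I$ ($x\in\{cli,dlv\}$), $s^{cli}_{E/\mathbf X}(\mathbf x)^H$ and $s^{dlv}_{E/\mathbf X}(\mathbf x)^H$ consist of all tuples $(t_1,\dots,t_k)^{\mathbf X\mathbf Y}_{\mathbf x\mathbf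 y}$, $\mathbf y$ ground, such that all formulas $\tau^{x}(l_j)^{\mathbf X\mathbf Y}_{\mathbf x\mathbf y}$ are satisfied by $I$; all $\tau^{cli}(l_j)^{\mathbf X\mathbf Y}_{\mathbf x\mathbf y}$ by $\langle H,I\rangle$; and all $\tau^{dlv}(l_j)^{\mathbf X\mathbf Y}_{\mathbf x\mathbf y}$ by $H$, respectively. An *agg-ht-model* of a theory is an agg-ht-interpretation satisfying it. **Answer sets.** $\tau\Pi$ is the infinitary propositional conjunction of all formulas $\tau(B_1)^{\mathbf Z}_{\mathbf z}\wedge\dots\wedge\tau(B_n)^{\mathbf Z}_{\mathbf z}\to\mathit{Head}^{\mathbf Z}_{\mathbf z}$ for the rules of $\Pi$, $\mathbf Z$ being the list of global variables and $\mathbf z$ ranging over tuples of ground terms. Here ground atoms are unchanged, a ground comparison becomes $\top$ or $\bot$ according to its truth, $\mathit{not}$ becomes $\neg$, and an aggregate atom $\#\mathrm{op}\{t_1,\dots,t_k:l_1,\dots,l_m\}\prec u$ whose global variables have been replaced by ground terms becomes $$\bigwedge_{\Delta}\Big(\bigwedge_{\mathbf y\in\Delta}\mathbf l_{\mathbf y}\to\bigvee_{\mathbf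 y\notin\Delta}\mathbf l_{\mathbf y}\Big),$$ where $\mathbf y$ ranges over the tuples of ground terms for the local (non-global) variables of the element, $\mathbf l_{\mathbf y}$ is the conjunction of the $\tau$-translations of the corresponding instances of the $l_j$, and $\Delta$ ranges over the sets of such tuples for which $\widehat{\mathrm{op}}(\{(t_1,\dots,t_k)_{\mathbf y}:\mathbf y\in\Delta\})\prec u$ fails. A set $A$ of ground atoms is a *clingo answer set* of $\Pi$ if it is a $\subseteq$-minimal model of the FT-reduct $(\tau\Pi)^A$, where $a^A$ is $a$ if $a\in A$ and $\bot$ otherwise, $(\cdot)^A$ commutes with conjunctions and disjunctions, and $(F\to G)^A$ is $F^A\to G^A$ if $A\models F\to G$ and $\bot$ otherwise. $A$ is a *dlv answer set* of $\Pi$ if it is a $\subseteq$-minimal model of the FLP-reduct of $\tau\Pi$, obtained by replacing by $\top$ each conjunctive term $F_1\to F_2$ of $\tau\Pi$ as displayed above (one for each rule and each $\mathbf z$) with $A\not\models F_1$. **Theorem.** Let $\Pi_1,\Pi_2$ be programs and $\sigma(\mathcal P,\mathcal S)$ a signature as above whose sets $\mathcal P$, $\mathcal S$ contain all predicate symbols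 and all set symbols occurring in $\Pi_1\cup\Pi_2$. The following are equivalent. 1. $\tau^{cli}(\Pi_1)$ and $\tau^{dlv}(\Pi_2)$ have the same agg-ht-models over $\sigma(\mathcal P,\mathcal S)$. 2. For every set $\Delta$ of rules such that $\tau^{cli}(\Delta)$ and $\tau^{dlv}(\Delta)$ have the same agg-ht-models (over $\sigma(\mathcal P,\mathcal S)$ extended by the predicate and set symbols occurring in $\Delta$), the clingo answer sets of $\Pi_1\cup\Delta$ coincide with the dlv answer sets of $\Pi_2\cup\Delta$. -/

import Mathlib

namespace AggASP

/-! ### Extended first-order logic over a many-sorted signature -/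

/-- A many-sorted signature (no proper subsorts are needed: a sort is a subsort of itself only). -/
structure MSig where
  Srt : Type
  Fn : Type
  Pr : Type
  fnArity : Fn → ℕ
  fnArg : (f : Fn) → Fin (fnArity f) → Srt
  fnVal : Fn → Srt
  prArity : Pr → ℕ
  prArg : (p : Pr) → Fin (prArity p) → Srt

/-- Terms of each sort; `Var s` is the set of object variables of sort `s`. -/
inductive MTerm (σ : MSig) (Var : σ.Srt → Type) : σ.Srt → Type
  | var {s : σ.Srt} (v : Var s) : MTerm σ Var s
  | app (f : σ.Fn) (args : (i : Fin (σ.fnArity f)) → MTerm σ Var (σ.fnArg f i)) :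
      MTerm σ Var (σ.fnVal f)

/-- Extended formulas: first-order formulas with the additional unary connective `sneg`. -/
inductive Fml (σ : MSig) (Var : σ.Srt → Type) : Type
  | bot : Fml σ Var
  | atom (p : σ.Pr) (args : (i : Fin (σ.prArity p)) → MTerm σ Var (σ.prArg p i)) : Fml σ Var
  | eq {s : σ.Srt} (t u : MTerm σ Var s) : Fml σ Var
  | sneg (F : Fml σ Var) : Fml σ Var
  | and (F G : Fml σ Var) : Fml σ Var
  | or (F G : Fml σ Var) : Fml σ Var
  | imp (F G : Fml σ Var) : Fml σ Var
  | all {s : σ.Srt} (v : Var s) (F : Fml σ Var) : Fml σ Var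
  | ex {s : σ.Srt} (v : Var s) (F : Fml σ Var) : Fml σ Var

/-- `¬ F` abbreviates `F → ⊥`. -/
def Fml.neg {σ : MSig} {Var : σ.Srt → Type} (F : Fml σ Var) : Fml σ Var := F.imp .bot

/-- `⊤` abbreviates `⊥ → ⊥`. -/
def Fml.top {σ : MSig} {Var : σ.Srt → Type} : Fml σ Var := Fml.bot.imp .bot

/-- The conjunction of a finite list of formulas. -/
def Fml.conj {σ : MSig} {Var : σ.Srt → Type} (l : List (Fml σ Var)) : Fml σ Var :=
  l.foldr Fml.and Fml.top

/-- An interpretation of `σ` with universes `D s`. -/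
structure Interp (σ : MSig) (D : σ.Srt → Type) where
  fn : (f : σ.Fn) → ((i : Fin (σ.fnArity f)) → D (σ.fnArg f i)) → D (σ.fnVal f)
  pr : (p : σ.Pr) → ((i : Fin (σ.prArity p)) → D (σ.prArg p i)) → Prop

/-- Assignments of domain elements to object variables. -/
abbrev Valuation {σ : MSig} (Var : σ.Srt → Type) (D : σ.Srt → Type) : Type :=
  (x : Sigma Var) → D x.1

section Satisfaction

variable {σ : MSig} {Var : σ.Srt → Type} {D : σ.Srt → Type}

/-- The valuation that maps `v` to `d` and agrees with `ν` elsewhere. -/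
noncomputable def Valuation.upd (ν : Valuation Var D) {s : σ.Srt} (v : Var s) (d : D s) :
    Valuation Var D :=
  letI : DecidableEq (Sigma Var) := Classical.decEq _
  Function.update ν ⟨s, v⟩ d

def MTerm.eval (I : Interp σ D) (ν : Valuation Var D) : {s : σ.Srt} → MTerm σ Var s → D s
  | _, .var v => ν ⟨_, v⟩
  | _, .app f args => I.fn f (fun i => (args i).eval I ν)

/-- Classical satisfaction `I ⊨ F`. -/
def Fml.Sat (I : Interp σ D) : Valuation Var D → Fml σ Var → Prop
  | _, .bot => False
  | ν, .atom p args => I.pr p (fun i => (args i).eval I ν)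
  | ν, .eq t u => t.eval I ν = u.eval I ν
  | ν, .sneg F => ¬ F.Sat I ν
  | ν, .and F G => F.Sat I ν ∧ G.Sat I ν
  | ν, .or F G => F.Sat I ν ∨ G.Sat I ν
  | ν, .imp F G => F.Sat I ν → G.Sat I ν
  | ν, .all v F => ∀ d, F.Sat I (ν.upd v d)
  | ν, .ex v F => ∃ d, F.Sat I (ν.upd v d)

/-- Here-and-there satisfaction `⟨H, I⟩ ⊨ F`. -/
def Fml.HTSat (H I : Interp σ D) : Valuation Var D → Fml σ Var → Prop
  | _, .bot => False
  | ν, .atom p args =>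
      I.pr p (fun i => (args i).eval I ν) ∧ H.pr p (fun i => (args i).eval H ν)
  | ν, .eq t u => t.eval I ν = u.eval I ν ∧ t.eval H ν = u.eval H ν
  | ν, .sneg F => ¬ F.Sat I ν ∧ ¬ F.Sat H ν
  | ν, .and F G => F.HTSat H I ν ∧ G.HTSat H I ν
  | ν, .or F G => F.HTSat H I ν ∨ G.HTSat H I ν
  | ν, .imp F G => (F.imp G).Sat I ν ∧ (¬ F.HTSat H I ν ∨ G.HTSat H I ν)
  | ν, .all v F => ∀ d, F.HTSat H I (ν.upd v d)
  | ν, .ex v F => ∃ d, F.HTSat H I (ν.upd v d)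

/-- `⟨H, I⟩` satisfies every sentence of the theory `Γ`. -/
def HTModels (H I : Interp σ D) (Γ : Set (Fml σ Var)) : Prop :=
  ∀ F ∈ Γ, ∀ ν : Valuation Var D, F.HTSat H I ν

/-- The relation `H ⪯ I`, with `IP` and `IF` the intensional predicate and function constants;
that `H` and `I` have the same universes is part of the types. -/
structure Interp.Below (IP : Set σ.Pr) (IF : Set σ.Fn) (H I : Interp σ D) : Prop where
  pr_subset : ∀ p ∈ IP, ∀ a, H.pr p a → I.pr p a
  pr_eq : ∀ p ∉ IP, H.pr p = I.pr p
  fn_eq : ∀ f ∉ IF, H.fn f = I.fn f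

end Satisfaction

/-! ### Syntax of programs with aggregates -/

/-- Ground terms over the symbolic constants `C`. -/
inductive GTerm (C : Type) : Type
  | inf : GTerm C
  | num (n : ℤ) : GTerm C
  | const (c : C) : GTerm C
  | sup : GTerm C

/-- The conditions on the total order of ground terms. -/
structure IsTermOrder (C : Type) [LinearOrder (GTerm C)] : Prop where
  inf_le : ∀ t : GTerm C, GTerm.inf ≤ t
  le_sup : ∀ t : GTerm C, t ≤ GTerm.sup
  num_lt_num : ∀ m n : ℤ, (GTerm.num m : GTerm C) < GTerm.num n ↔ m < n
  num_lt_const : ∀ (n : ℤ) (c : C), GTerm.num n < GTerm.const c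

/-- Program terms over the symbolic constants `C` and the program variables `V`. -/
inductive PTerm (C V : Type) : Type
  | var (v : V) : PTerm C V
  | gnd (g : GTerm C) : PTerm C V

/-- Comparison symbols other than equality. -/
inductive OrdRel : Type
  | ne | lt | gt | le | ge

inductive CmpSym : Type
  | eq : CmpSym
  | rel (r : OrdRel) : CmpSym

/-- The atom `p(t₁, …, tₙ)`. -/
structure PAtom (C V : Type) where
  pred : C
  args : List (PTerm C V)

inductive AtomicFormula (C V : Type) : Type
  | atom (a : PAtom C V) : AtomicFormula C V
  | cmp (t : PTerm C V) (c : CmpSym) (u : PTerm C V) : AtomicFormula C V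

/-- No, one or two occurrences of `not`. -/
inductive NegPrefix : Type
  | pos | naf | nafnaf

structure BasicLit (C V : Type) where
  pre : NegPrefix
  body : AtomicFormula C V

/-- The aggregate element `t₁, …, tₖ : l₁, …, lₘ`. -/
structure AggElem (C V : Type) where
  terms : List (PTerm C V)
  lits : List (BasicLit C V)

inductive OpName : Type
  | count | sum

/-- The aggregate atom `#op{E} ≺ u`. -/
structure AggAtom (C V : Type) where
  op : OpName
  elem : AggElem C V
  cmp : CmpSym
  guard : PTerm C V

inductive Lit (C V : Type) : Type
  | basic (l : BasicLit C V) : Lit C V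
  | agg (pre : NegPrefix) (A : AggAtom C V) : Lit C V

/-- Rules; the head `none` stands for `⊥`. -/
structure Rule (C V : Type) where
  head : Option (PAtom C V)
  body : List (Lit C V)

/-- Programs are arbitrary (possibly infinite) sets of rules. -/
abbrev Program (C V : Type) : Type := Set (Rule C V)

section Syntactic

variable {C V : Type}

def PTerm.vars : PTerm C V → List V
  | .var v => [v]
  | .gnd _ => []

def PAtom.vars (a : PAtom C V) : List V := a.args.flatMap PTerm.vars

def AtomicFormula.vars : AtomicFormula C V → List V
  | .atom a => a.vars
  | .cmp t _ u => t.vars ++ u.vars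

def BasicLit.vars (l : BasicLit C V) : List V := l.body.vars

def AggElem.vars (E : AggElem C V) : List V :=
  E.terms.flatMap PTerm.vars ++ E.lits.flatMap BasicLit.vars

/-- The variables that a body literal makes global: all its variables if it is basic, those of
its guard if it is an aggregate literal. -/
def Lit.globalVars : Lit C V → List V
  | .basic l => l.vars
  | .agg _ A => A.guard.vars

/-- The global variables of a rule. -/
def Rule.globals [DecidableEq V] (R : Rule C V) : Finset V :=
  (((R.head.map PAtom.vars).getD []) ++ R.body.flatMap Lit.globalVars).toFinset

/-- The predicate symbol `p/n`. -/
abbrev PredSym (C : Type) : Type := C × ℕ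

def PAtom.sym (a : PAtom C V) : PredSym C := (a.pred, a.args.length)

def AtomicFormula.preds : AtomicFormula C V → Set (PredSym C)
  | .atom a => {a.sym}
  | .cmp _ _ _ => ∅

def AggElem.preds (E : AggElem C V) : Set (PredSym C) := {p | ∃ l ∈ E.lits, p ∈ l.body.preds}

def Lit.preds : Lit C V → Set (PredSym C)
  | .basic l => l.body.preds
  | .agg _ A => A.elem.preds

def Rule.preds (R : Rule C V) : Set (PredSym C) :=
  {p | (∃ a ∈ R.head, p = a.sym) ∨ ∃ B ∈ R.body, p ∈ B.preds}

/-- The predicate symbols occurring in a program. -/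
def predsOf (Pi : Program C V) : Set (PredSym C) := {p | ∃ R ∈ Pi, p ∈ R.preds}

variable (C V) in
/-- A set symbol `E/X`: an aggregate element and a list of distinct variables occurring in it. -/
structure SetSym where
  elem : AggElem C V
  vars : List V
  nodup : vars.Nodup
  occurs : ∀ v ∈ vars, v ∈ elem.vars

variable [LinearOrder V]

/-- The set symbol `E/X` with `X` the ordered list of the variables of `E` that belong to `Z`. -/
def setSym (E : AggElem C V) (Z : Finset V) : SetSym C V where
  elem := E
  vars := (E.vars.toFinset ∩ Z).sort (· ≤ ·)
  nodup := Finset.sort_nodup _ _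
  occurs := fun v hv => by
    rw [Finset.mem_sort, Finset.mem_inter, List.mem_toFinset] at hv
    exact hv.1

def Rule.setSyms (R : Rule C V) : Set (SetSym C V) :=
  {e | ∃ pre A, Lit.agg pre A ∈ R.body ∧ e = setSym A.elem R.globals}

/-- The set symbols occurring in a program. -/
def setSymsOf (Pi : Program C V) : Set (SetSym C V) := {e | ∃ R ∈ Pi, e ∈ R.setSyms}

end Syntactic

/-! ### Comparisons and aggregate operations on ground terms -/

section Operations

variable {C : Type}

def OrdRel.Holds [LinearOrder (GTerm C)] : OrdRel → GTerm C → GTerm C → Prop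
  | .ne, t, u => t ≠ u
  | .lt, t, u => t < u
  | .gt, t, u => t > u
  | .le, t, u => t ≤ u
  | .ge, t, u => t ≥ u

def CmpSym.Holds [LinearOrder (GTerm C)] : CmpSym → GTerm C → GTerm C → Prop
  | .eq, t, u => t = u
  | .rel r, t, u => r.Holds t u

/-- The weight of a tuple of ground terms. -/
def weight : List (GTerm C) → ℤ
  | .num n :: _ => n
  | _ => 0

open Classical in
noncomputable def countHat (T : Set (List (GTerm C))) : GTerm C :=
  if T.Finite then .num T.ncard else .sup

open Classical in
noncomputable def sumHat (T : Set (List (GTerm C))) : GTerm C :=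
  if h : {t ∈ T | weight t ≠ 0}.Finite then .num (∑ t ∈ h.toFinset, weight t) else .num 0

noncomputable def OpName.hat : OpName → Set (List (GTerm C)) → GTerm C
  | .count => countHat
  | .sum => sumHat

end Operations

/-! ### The target signature and standard interpretations -/

/-- The data `P`, `S` of a target signature: predicate symbols and set symbols, the predicate
symbols occurring in the elements of `S` being among those of `P`. -/
structure ProgSig (C V : Type) where
  P : Set (PredSym C)
  S : Set (SetSym C V)
  closed : ∀ e ∈ S, e.elem.preds ⊆ P

/-- All predicate symbols and set symbols occurring in the program belong to the signature. -/
def ProgSig.Covers {C V : Type} [LinearOrder V] (g : ProgSig C V) (Pi : Program C V) : Prop :=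
  predsOf Pi ⊆ g.P ∧ setSymsOf Pi ⊆ g.S

/-- The signature extended by all predicate symbols and set symbols occurring in a program. -/
def ProgSig.extend {C V : Type} [LinearOrder V] (g : ProgSig C V) (Pi : Program C V) :
    ProgSig C V where
  P := g.P ∪ predsOf Pi
  S := g.S ∪ setSymsOf Pi
  closed := by
    rintro e (he | ⟨R, hR, pre, A, hA, rfl⟩) p hp
    · exact Or.inl (g.closed e he hp)
    · exact Or.inr ⟨R, hR, Or.inr ⟨_, hA, hp⟩⟩

/-- The two semantics, `clingo` and `dlv`. -/
inductive Sem : Type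
  | cli | dlv

/-- The general sort, the tuple sort and the set sort. -/
inductive TSort : Type
  | gen | tup | sset

section Target

variable {C V : Type}

/-- Function constants of the target signature. -/
inductive TFn (g : ProgSig C V) : Type
  | obj (t : GTerm C) : TFn g
  | tuple (k : ℕ) (hk : ∃ e ∈ g.S, e.elem.terms.length = k) : TFn g
  | op (o : OpName) : TFn g
  | setFn (x : Sem) (e : SetSym C V) (he : e ∈ g.S) : TFn g

/-- Predicate constants of the target signature, other than equality. -/
inductive TPr (g : ProgSig C V) : Type
  | pred (p : PredSym C) (hp : p ∈ g.P) : TPr g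
  | cmp (r : OrdRel) : TPr g
  | mem : TPr g

/-- The target signature `σ(P, S)`. -/
abbrev ProgSig.sig (g : ProgSig C V) : MSig where
  Srt := TSort
  Fn := TFn g
  Pr := TPr g
  fnArity := fun
    | .obj _ => 0
    | .tuple k _ => k
    | .op _ => 1
    | .setFn _ e _ => e.vars.length
  fnArg := fun
    | .obj _ => fun _ => .gen
    | .tuple _ _ => fun _ => .gen
    | .op _ => fun _ => .sset
    | .setFn _ _ _ => fun _ => .gen
  fnVal := fun
    | .obj _ => .gen
    | .tuple _ _ => .tup
    | .op _ => .gen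
    | .setFn _ _ _ => .sset
  prArity := fun
    | .pred p _ => p.2
    | .cmp _ => 2
    | .mem => 2
  prArg := fun
    | .pred _ _ => fun _ => .gen
    | .cmp _ => fun _ => .gen
    | .mem => fun i : Fin 2 => match i with
      | 0 => .tup
      | 1 => .sset

/-- The intensional predicate constants: those of `P`. -/
def ProgSig.intPr (g : ProgSig C V) : Set g.sig.Pr := {q | ∃ p hp, q = TPr.pred p hp}

/-- The intensional function constants: those corresponding to the set symbols in `S`. -/
def ProgSig.intFn (g : ProgSig C V) : Set g.sig.Fn := {f | ∃ x e he, f = TFn.setFn x e he}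

/-- Object variables: those of the general sort are the program variables. The sentences that
programs are translated to have no variables of the other two sorts, so none are provided;
the universe of the tuple sort may then be empty, as it is when `S` is empty. -/
abbrev TVar (V : Type) : TSort → Type
  | .gen => V
  | .tup => Empty
  | .sset => Empty

abbrev TTerm (g : ProgSig C V) : Type := MTerm g.sig (TVar V) TSort.gen

abbrev TFml (g : ProgSig C V) : Type := Fml g.sig (TVar V)

/-- The tuples of ground terms of length `k`, for each `k` that is the number of terms of an
aggregate element of a set symbol in `S`. -/
abbrev Tup (g : ProgSig C V) : Type :=
  {t : List (GTerm C) // ∃ e ∈ g.S, e.elem.terms.length = t.length}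

/-- The universes of a standard interpretation; the universe `U` of the set sort may be any
collection of sets of elements of the tuple sort. -/
abbrev StdDom (g : ProgSig C V) (U : Set (Set (Tup g))) : TSort → Type
  | .gen => GTerm C
  | .tup => Tup g
  | .sset => U

variable {g : ProgSig C V} {U : Set (Set (Tup g))}

/-- An element of the set sort as a set of tuples of ground terms. -/
def tuplesOf (d : U) : Set (List (GTerm C)) := {t | ∃ u : Tup g, u ∈ d.1 ∧ u.1 = t}

/-- Interpretations of `σ(P, S)` with the universes of a standard interpretation. -/
abbrev TInterp (g : ProgSig C V) (U : Set (Set (Tup g))) : Type := Interp g.sig (StdDom g U)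

/-- The value `s^x_{E/X}(a)` in an interpretation, as a set of tuples of ground terms. -/
def setVal (I : TInterp g U) (x : Sem) (e : SetSym C V) (he : e ∈ g.S)
    (a : Fin e.vars.length → GTerm C) : Set (List (GTerm C)) :=
  tuplesOf (g := g) (U := U) (I.fn (TFn.setFn x e he) a)

/-- Standard interpretations (the conditions on the universes are part of the type). -/
structure IsStandard [LinearOrder (GTerm C)] (I : TInterp g U) : Prop where
  obj : ∀ (t : GTerm C) (a), I.fn (TFn.obj t) a = t
  cmp : ∀ (r : OrdRel) (a : Fin 2 → GTerm C), I.pr (TPr.cmp r) a ↔ r.Holds (a 0) (a 1)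
  tuple : ∀ (k : ℕ) (hk) (a : Fin k → GTerm C),
    (show Tup g from I.fn (TFn.tuple k hk) a).1 = List.ofFn a
  mem : ∀ a, I.pr TPr.mem a ↔
    (show Tup g from a (0 : Fin 2)) ∈ (show U from a (1 : Fin 2)).1
  op : ∀ (o : OpName) (d : U), I.fn (TFn.op o) (fun _ => d) = o.hat (tuplesOf d)

/-- The valuation given by an assignment of ground terms to the program variables. -/
def valOf (θ : V → GTerm C) : Valuation (σ := g.sig) (TVar V) (StdDom g U)
  | ⟨TSort.gen, v⟩ => θ v
  | ⟨TSort.tup, v⟩ => Empty.elim v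
  | ⟨TSort.sset, v⟩ => Empty.elim v

/-! ### The translations `τ^cli` and `τ^dlv` -/

/-- `not` is translated as `¬` for `clingo` and as `sneg` for `dlv`. -/
def trNeg : Sem → NegPrefix → TFml g → TFml g
  | _, .pos, F => F
  | .cli, .naf, F => F.neg
  | .cli, .nafnaf, F => F.neg.neg
  | .dlv, .naf, F => F.sneg
  | .dlv, .nafnaf, F => F.sneg.sneg

def trTerm : PTerm C V → TTerm g
  | .var v => MTerm.var (σ := g.sig) (s := TSort.gen) v
  | .gnd t => MTerm.app (σ := g.sig) (TFn.obj t) (fun i => Fin.elim0 i)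

def trCmp : CmpSym → TTerm g → TTerm g → TFml g
  | .eq, t, u => Fml.eq t u
  | .rel r, t, u => Fml.atom (σ := g.sig) (TPr.cmp r) ![t, u]

open Classical in
/-- Atoms stand for themselves. (The value `⊥` is given only to an atom whose predicate symbol
is not in the signature.) -/
noncomputable def trAtom (a : PAtom C V) : TFml g :=
  if h : a.sym ∈ g.P then
    Fml.atom (σ := g.sig) (TPr.pred a.sym h)
      (fun i : Fin a.args.length => trTerm (a.args.get i))
  else Fml.bot

noncomputable def trAtomic : AtomicFormula C V → TFml g
  | .atom a => trAtom a
  | .cmp t c u => trCmp c (trTerm t) (trTerm u)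

noncomputable def trBasic (x : Sem) (l : BasicLit C V) : TFml g := trNeg x l.pre (trAtomic l.body)

/-- The term `op(s^x_{E/X}(X))`. -/
def aggTerm (x : Sem) (o : OpName) (e : SetSym C V) (he : e ∈ g.S) : TTerm g :=
  MTerm.app (σ := g.sig) (TFn.op o) (fun _ =>
    MTerm.app (σ := g.sig) (TFn.setFn x e he)
      (fun i : Fin e.vars.length => trTerm (.var (e.vars.get i))))

variable [LinearOrder V]

open Classical in
/-- The aggregate atom `#op{E} ≺ u` becomes `op(s^x_{E/X}(X)) ≺ u`, with `X` the ordered list of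
the variables of `E` in `Z`. (The value `⊥` is given only if `E/X` is not in the signature.) -/
noncomputable def trAgg (x : Sem) (Z : Finset V) (A : AggAtom C V) : TFml g :=
  if h : setSym A.elem Z ∈ g.S then
    trCmp A.cmp (aggTerm x A.op (setSym A.elem Z) h) (trTerm A.guard)
  else Fml.bot

noncomputable def trLit (x : Sem) (Z : Finset V) : Lit C V → TFml g
  | .basic l => trBasic x l
  | .agg pre A => trNeg x pre (trAgg x Z A)

noncomputable def trHead : Option (PAtom C V) → TFml g
  | none => Fml.bot
  | some a => trAtom a

/-- `τ^x R`: the universal closure of `τ^x B₁ ∧ … ∧ τ^x Bₙ → Head`. -/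
noncomputable def trRule (x : Sem) (R : Rule C V) : TFml g :=
  (R.globals.sort (· ≤ ·)).foldr
    (fun v F => Fml.all (σ := g.sig) (s := TSort.gen) v F)
    (Fml.imp (Fml.conj (R.body.map (trLit x R.globals))) (trHead R.head))

variable (g) in
/-- `τ^x Π`, as a theory over `σ(P, S)`. -/
noncomputable def trProgram (x : Sem) (Pi : Program C V) : Set (TFml g) :=
  {F | ∃ R ∈ Pi, F = trRule x R}

end Target

/-! ### agg-interpretations and agg-ht-models -/

section Agg

variable {C V : Type} {g : ProgSig C V} {U : Set (Set (Tup g))}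

def PTerm.inst (θ : V → GTerm C) : PTerm C V → GTerm C
  | .var v => θ v
  | .gnd t => t

/-- All tuples obtained from the terms of `E` by replacing the variables `X` by `a` and the
remaining variables by ground terms so that the instance of every literal `l` of `E`
satisfies `Q`; the replacement is given by an assignment `θ` of ground terms to variables. -/
def instances (e : SetSym C V) (a : Fin e.vars.length → GTerm C)
    (Q : (V → GTerm C) → BasicLit C V → Prop) : Set (List (GTerm C)) :=
  {t | ∃ θ : V → GTerm C, (∀ i, θ (e.vars.get i) = a i) ∧
    t = e.elem.terms.map (PTerm.inst θ) ∧ ∀ l ∈ e.elem.lits, Q θ l}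

structure IsAggInterp [LinearOrder (GTerm C)] (I : TInterp g U) : Prop where
  standard : IsStandard I
  sets : ∀ (x : Sem) (e : SetSym C V) (he : e ∈ g.S) (a : Fin e.vars.length → GTerm C),
    setVal I x e he a = instances e a (fun θ l => (trBasic x l).Sat I (valOf θ))

/-- `⟨H, I⟩` is an agg-ht-interpretation. -/
structure IsAggHTInterp [LinearOrder (GTerm C)] (H I : TInterp g U) : Prop where
  below : Interp.Below g.intPr g.intFn H I
  here : IsStandard H
  there : IsAggInterp I
  cli : ∀ (e : SetSym C V) (he : e ∈ g.S) (a : Fin e.vars.length → GTerm C),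
    setVal H .cli e he a = instances e a (fun θ l => (trBasic .cli l).HTSat H I (valOf θ))
  dlv : ∀ (e : SetSym C V) (he : e ∈ g.S) (a : Fin e.vars.length → GTerm C),
    setVal H .dlv e he a = instances e a (fun θ l => (trBasic .dlv l).Sat H (valOf θ))

/-- Two theories over `σ(P, S)` have the same agg-ht-models. -/
def SameAggHTModels [LinearOrder (GTerm C)] (Γ₁ Γ₂ : Set (TFml g)) : Prop :=
  ∀ (U : Set (Set (Tup g))) (H I : TInterp g U), IsAggHTInterp H I →
    (HTModels H I Γ₁ ↔ HTModels H I Γ₂)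

end Agg

/-! ### Infinitary propositional formulas, reducts and minimal models -/

/-- (Standard) infinitary propositional formulas; sets of formulas are given as families. -/
inductive InfFml (α : Type) : Type 1
  | atom (a : α) : InfFml α
  | conj {ι : Type} (F : ι → InfFml α) : InfFml α
  | disj {ι : Type} (F : ι → InfFml α) : InfFml α
  | imp (F G : InfFml α) : InfFml α

namespace InfFml

variable {α : Type}

def top : InfFml α := conj (ι := Empty) Empty.elim

def bot : InfFml α := disj (ι := Empty) Empty.elim

def neg (F : InfFml α) : InfFml α := F.imp bot

/-- Satisfaction by a set of atoms. -/
def Sat (A : Set α) : InfFml α → Prop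
  | atom a => a ∈ A
  | conj F => ∀ i, (F i).Sat A
  | disj F => ∃ i, (F i).Sat A
  | imp F G => F.Sat A → G.Sat A

open Classical in
/-- The FT-reduct of a formula with respect to `A`. -/
noncomputable def ftReduct (A : Set α) : InfFml α → InfFml α
  | atom a => if a ∈ A then atom a else bot
  | conj F => conj (fun i => (F i).ftReduct A)
  | disj F => disj (fun i => (F i).ftReduct A)
  | imp F G => if (imp F G).Sat A then imp (F.ftReduct A) (G.ftReduct A) else bot

open Classical in
/-- The FLP-reduct of a conjunction of (conjunctions of) implications with respect to `A`. -/
noncomputable def flpReduct (A : Set α) : InfFml α → InfFml α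
  | conj F => conj (fun i => (F i).flpReduct A)
  | imp F G => if F.Sat A then imp F G else top
  | F => F

/-- `A` is a `⊆`-minimal model of `F`. -/
def IsMinimalModel (A : Set α) (F : InfFml α) : Prop := F.Sat A ∧ ∀ B, B ⊂ A → ¬ F.Sat B

end InfFml

/-! ### The propositional translation `τ` and the answer sets of `clingo` and `dlv` -/

/-- Ground atoms `p(t₁, …, tₙ)`. -/
structure GAtom (C : Type) where
  pred : C
  args : List (GTerm C)

section Grounding

variable {C V : Type} [LinearOrder (GTerm C)]

def PAtom.inst (θ : V → GTerm C) (a : PAtom C V) : GAtom C :=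
  ⟨a.pred, a.args.map (PTerm.inst θ)⟩

def tauNeg : NegPrefix → InfFml (GAtom C) → InfFml (GAtom C)
  | .pos, F => F
  | .naf, F => F.neg
  | .nafnaf, F => F.neg.neg

open Classical in
/-- `τ` of the instance under `θ` of an atomic formula. -/
noncomputable def tauAtomic (θ : V → GTerm C) : AtomicFormula C V → InfFml (GAtom C)
  | .atom a => .atom (a.inst θ)
  | .cmp t c u => if c.Holds (t.inst θ) (u.inst θ) then .top else .bot

noncomputable def tauBasic (θ : V → GTerm C) (l : BasicLit C V) : InfFml (GAtom C) :=
  tauNeg l.pre (tauAtomic θ l.body)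

/-- `τ` of the conjunction of the instances under `θ` of the literals of `E`. -/
noncomputable def tauLits (θ : V → GTerm C) (E : AggElem C V) : InfFml (GAtom C) :=
  .conj (fun i : Fin E.lits.length => tauBasic θ (E.lits.get i))

variable [LinearOrder V]

/-- The local variables of `E` in a rule with global variables `Z`. -/
def AggElem.locals (E : AggElem C V) (Z : Finset V) : Finset V := E.vars.toFinset \ Z

/-- The assignment given by `y` on the variables in `Y` and by `θ` elsewhere. -/
def override (θ : V → GTerm C) (Y : Finset V) (y : Y → GTerm C) : V → GTerm C :=
  fun v => if h : v ∈ Y then y ⟨v, h⟩ else θ v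

/-- The set `Δ` of tuples of ground terms for the local variables justifies the instance of the
aggregate atom `A` under `θ`. -/
def AggAtom.Justifies (A : AggAtom C V) (Z : Finset V) (θ : V → GTerm C)
    (Δ : Set (A.elem.locals Z → GTerm C)) : Prop :=
  A.cmp.Holds
    (A.op.hat {t | ∃ y ∈ Δ, t = A.elem.terms.map (PTerm.inst (override θ (A.elem.locals Z) y))})
    (A.guard.inst θ)

/-- `τ` of the instance under `θ` of an aggregate atom: the conjunction over all sets `Δ` that do
not justify it of `⋀_{y ∈ Δ} l_y → ⋁_{y ∉ Δ} l_y`. -/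
noncomputable def tauAgg (Z : Finset V) (θ : V → GTerm C) (A : AggAtom C V) :
    InfFml (GAtom C) :=
  .conj (fun Δ : {Δ : Set (A.elem.locals Z → GTerm C) // ¬ A.Justifies Z θ Δ} =>
    .imp
      (.conj (fun y : {y // y ∈ Δ.1} => tauLits (override θ (A.elem.locals Z) y.1) A.elem))
      (.disj (fun y : {y // y ∉ Δ.1} => tauLits (override θ (A.elem.locals Z) y.1) A.elem)))

noncomputable def tauLit (Z : Finset V) (θ : V → GTerm C) : Lit C V → InfFml (GAtom C)
  | .basic l => tauBasic θ l
  | .agg pre A => tauNeg pre (tauAgg Z θ A)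

def tauHead (θ : V → GTerm C) : Option (PAtom C V) → InfFml (GAtom C)
  | none => .bot
  | some a => .atom (a.inst θ)

/-- `τ R`: the conjunction of the instances of `R`. (An assignment `θ` matters only through its
values on the global variables of `R`.) -/
noncomputable def tauRule (R : Rule C V) : InfFml (GAtom C) :=
  .conj (fun θ : V → GTerm C =>
    .imp (.conj (fun i : Fin R.body.length => tauLit R.globals θ (R.body.get i)))
      (tauHead θ R.head))

/-- `τ Π`. -/
noncomputable def tauProgram (Pi : Program C V) : InfFml (GAtom C) :=
  .conj (fun R : {R : Rule C V // R ∈ Pi} => tauRule R.1)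

/-- The `clingo` answer sets of a program: the FT-stable models of `τ Π`. -/
def IsClingoAnswerSet (Pi : Program C V) (A : Set (GAtom C)) : Prop :=
  ((tauProgram Pi).ftReduct A).IsMinimalModel A

/-- The `dlv` answer sets of a program: the FLP-stable models of `τ Π`. -/
def IsDlvAnswerSet (Pi : Program C V) (A : Set (GAtom C)) : Prop :=
  ((tauProgram Pi).flpReduct A).IsMinimalModel A

end Grounding

end AggASP

set_option linter.unusedSectionVars false

/-! For programs covered by the signature, an agg-ht-interpretation `⟨H, I⟩` matters only through
the sets `X ⊆ Y` of ground atoms true in `H` and in `I`. Literals inside aggregate elements contain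
no set functions, so `X` and `Y` determine the values of all set functions, and every pair `X ⊆ Y`
arises in this way (`agrees_atomsOf`, `exists_isAggHTInterp`). In terms of such a pair, satisfying
`τ^cli` means that `X` satisfies the FT-reduct with respect to `Y` (`htModels_cli_iff`). Satisfying
`τ^dlv` means that `Y` is a model of the program and `X` a model of its FLP-reduct
(`htModels_dlv_iff`), because with `sneg` for `not` a body literal is evaluated in the two worlds
independently. Aggregates fit in because the infinitary conjunction over unjustified `Δ` just says
that the set of satisfied instances justifies the aggregate atom (`forall_unjustified_iff`).
Condition 1 thus becomes the equivalence of `CliSat Pi₁ X Y` and `DlvSat Pi₂ X Y` for all `X ⊆ Y`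
(`sameAggHTModels_iff`).

Answer sets are the fixed points `Y` of these relations that are minimal in the first argument, and
adding rules intersects relations, so condition 1 gives condition 2. Conversely, as in the classical
proof of strong equivalence, a pair `X ⊆ Y` on which the relations differ yields a context under
which exactly one program has `Y` as an answer set (`separates_of_not`). The context consists of
facts and rules with one positive body atom, for which the two semantics agree, so it is admissible
in condition 2. -/

namespace AggASP

/-! ### Reducts of infinitary formulas as satisfaction by pairs of sets of atoms. -/

section Propositional

variable {α : Type} {X Y : Set α}

namespace InfFml

theorem sat_bot : ¬ (bot : InfFml α).Sat X := fun ⟨i, _⟩ => i.elim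

theorem sat_top : (top : InfFml α).Sat X := fun i => i.elim

theorem sat_neg (F : InfFml α) : F.neg.Sat X ↔ ¬ F.Sat X := by
  simp [neg, Sat, sat_bot]

/-- Here-and-there satisfaction of an infinitary formula, expressed by the FT-reduct. -/
def HT (X Y : Set α) (F : InfFml α) : Prop := (F.ftReduct Y).Sat X

theorem ht_atom (a : α) : HT X Y (atom a) ↔ a ∈ Y ∧ a ∈ X := by
  by_cases h : a ∈ Y
  · simp [HT, ftReduct, h, Sat]
  · simp [HT, ftReduct, h, sat_bot]

theorem ht_conj {ι : Type} (F : ι → InfFml α) : HT X Y (conj F) ↔ ∀ i, HT X Y (F i) := by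
  simp [HT, ftReduct, Sat]

theorem ht_disj {ι : Type} (F : ι → InfFml α) : HT X Y (disj F) ↔ ∃ i, HT X Y (F i) := by
  simp [HT, ftReduct, Sat]

theorem ht_imp (F G : InfFml α) :
    HT X Y (imp F G) ↔ (F.Sat Y → G.Sat Y) ∧ (HT X Y F → HT X Y G) := by
  by_cases h : (imp F G).Sat Y
  · simp only [HT, ftReduct, h, if_true]
    exact ⟨fun h' => ⟨h, h'⟩, fun h' => h'.2⟩
  · simp only [HT, ftReduct, h, if_false]
    exact ⟨fun h' => (sat_bot h').elim, fun h' => (h h'.1).elim⟩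

theorem ht_bot : ¬ HT X Y (bot : InfFml α) := by
  rw [bot, ht_disj]
  exact fun ⟨i, _⟩ => i.elim

theorem ht_top : HT X Y (top : InfFml α) := by
  rw [top, ht_conj]
  exact fun i => i.elim

theorem ht_neg (F : InfFml α) : HT X Y F.neg ↔ ¬ F.Sat Y ∧ ¬ HT X Y F := by
  simp [neg, ht_imp, sat_bot, ht_bot]

theorem sat_flpReduct_conj {ι : Type} (F : ι → InfFml α) :
    ((conj F).flpReduct Y).Sat X ↔ ∀ i, ((F i).flpReduct Y).Sat X := Iff.rfl

theorem sat_conj_iff {ι : Type} (F : ι → InfFml α) : (conj F).Sat X ↔ ∀ i, (F i).Sat X := Iff.rfl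

theorem sat_flpReduct_imp (F G : InfFml α) :
    ((imp F G).flpReduct Y).Sat X ↔ (F.Sat Y → F.Sat X → G.Sat X) := by
  by_cases h : F.Sat Y
  · simp only [flpReduct, h, if_true]
    exact ⟨fun h' _ => h', fun h' => h' trivial⟩
  · simp only [flpReduct, h, if_false]
    exact ⟨fun _ h' => h'.elim, fun _ => sat_top⟩

/-- No inclusion of `X` in `Y` is needed: the reduct replaces by `⊥` every atom and every
implication that fails in `Y`. -/
theorem HT.sat {F : InfFml α} (h : HT X Y F) : F.Sat Y := by
  induction F with
  | atom a => exact ((ht_atom a).1 h).1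
  | conj F ih => exact fun i => ih i ((ht_conj F).1 h i)
  | disj F ih =>
    obtain ⟨i, hi⟩ := (ht_disj F).1 h
    exact ⟨i, ih i hi⟩
  | imp F G _ _ => exact ((ht_imp F G).1 h).1

theorem ht_self (F : InfFml α) : HT Y Y F ↔ F.Sat Y := by
  induction F with
  | atom a => simp [ht_atom, Sat]
  | conj F ih => simp [ht_conj, Sat, ih]
  | disj F ih => simp [ht_disj, Sat, ih]
  | imp F G ih₁ ih₂ => simp [ht_imp, Sat, ih₁, ih₂]

end InfFml

end Propositional

/-! ### Reducts of programs, rule instance by rule instance. -/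

section Programs

variable {C V : Type} [LinearOrder (GTerm C)] [LinearOrder V] {X Y : Set (GAtom C)}

/-- `Y` satisfies the body of the instance of `R` under `θ`. -/
def Rule.BodySat (R : Rule C V) (θ : V → GTerm C) (Y : Set (GAtom C)) : Prop :=
  ∀ B ∈ R.body, (tauLit R.globals θ B).Sat Y

/-- `⟨X, Y⟩` satisfies the body of the instance of `R` under `θ`. -/
def Rule.BodyHT (R : Rule C V) (θ : V → GTerm C) (X Y : Set (GAtom C)) : Prop :=
  ∀ B ∈ R.body, InfFml.HT X Y (tauLit R.globals θ B)

/-- `⟨X, Y⟩` is a model of `τ Π` in the logic of here-and-there. -/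
def CliSat (Pi : Program C V) (X Y : Set (GAtom C)) : Prop :=
  ∀ R ∈ Pi, ∀ θ : V → GTerm C,
    (R.BodySat θ Y → (tauHead θ R.head).Sat Y) ∧
    (R.BodyHT θ X Y → InfFml.HT X Y (tauHead θ R.head))

/-- `Y` is a model of `τ Π` and `X` is a model of its FLP-reduct with respect to `Y`. -/
def DlvSat (Pi : Program C V) (X Y : Set (GAtom C)) : Prop :=
  ∀ R ∈ Pi, ∀ θ : V → GTerm C,
    (R.BodySat θ Y → (tauHead θ R.head).Sat Y) ∧
    (R.BodySat θ Y → R.BodySat θ X → (tauHead θ R.head).Sat X)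

theorem forall_body {R : Rule C V} {p : Lit C V → Prop} :
    (∀ i : Fin R.body.length, p (R.body.get i)) ↔ ∀ B ∈ R.body, p B := by
  rw [List.forall_mem_iff_get]

theorem cliSat_iff (Pi : Program C V) : ((tauProgram Pi).ftReduct Y).Sat X ↔ CliSat Pi X Y := by
  change InfFml.HT X Y (tauProgram Pi) ↔ _
  simp only [tauProgram, InfFml.ht_conj, tauRule, InfFml.ht_imp, InfFml.Sat, CliSat, Subtype.forall,
    Rule.BodySat, Rule.BodyHT]
  refine forall_congr' fun R => forall_congr' fun _ => forall_congr' fun θ => ?_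
  rw [forall_body (p := fun B => (tauLit R.globals θ B).Sat Y),
    forall_body (p := fun B => InfFml.HT X Y (tauLit R.globals θ B))]

theorem sat_flpReduct (Pi : Program C V) : ((tauProgram Pi).flpReduct Y).Sat X ↔
    ∀ R ∈ Pi, ∀ θ : V → GTerm C,
      R.BodySat θ Y → R.BodySat θ X → (tauHead θ R.head).Sat X := by
  simp only [tauProgram, tauRule, InfFml.sat_flpReduct_conj, InfFml.sat_conj_iff,
    InfFml.sat_flpReduct_imp, Subtype.forall, Rule.BodySat]
  refine forall_congr' fun R => forall_congr' fun _ => forall_congr' fun θ => ?_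
  rw [forall_body (p := fun B => (tauLit R.globals θ B).Sat Y),
    forall_body (p := fun B => (tauLit R.globals θ B).Sat X)]

theorem CliSat.there {Pi : Program C V} (h : CliSat Pi X Y) : CliSat Pi Y Y := by
  rw [← cliSat_iff] at h ⊢
  exact (InfFml.ht_self _).2 (InfFml.HT.sat h)

theorem DlvSat.there {Pi : Program C V} (h : DlvSat Pi X Y) : DlvSat Pi Y Y :=
  fun R hR θ => ⟨(h R hR θ).1, fun h' _ => (h R hR θ).1 h'⟩

theorem cliSat_union {Pi Delta : Program C V} :
    CliSat (Pi ∪ Delta) X Y ↔ CliSat Pi X Y ∧ CliSat Delta X Y := by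
  simp only [CliSat, Set.mem_union, or_imp, forall_and]
  tauto

theorem dlvSat_union {Pi Delta : Program C V} :
    DlvSat (Pi ∪ Delta) X Y ↔ DlvSat Pi X Y ∧ DlvSat Delta X Y := by
  simp only [DlvSat, Set.mem_union, or_imp, forall_and]
  tauto

theorem isClingoAnswerSet_iff {Pi : Program C V} {A : Set (GAtom C)} :
    IsClingoAnswerSet Pi A ↔ CliSat Pi A A ∧ ∀ B, B ⊂ A → ¬ CliSat Pi B A := by
  simp only [IsClingoAnswerSet, InfFml.IsMinimalModel, cliSat_iff]

/-- The FLP-reduct does not by itself say that `A` is a model of the program, whereas `DlvSat` does.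
The difference vanishes here because `A` satisfies its own reduct exactly when it is a model. -/
theorem isDlvAnswerSet_iff {Pi : Program C V} {A : Set (GAtom C)} :
    IsDlvAnswerSet Pi A ↔ DlvSat Pi A A ∧ ∀ B, B ⊂ A → ¬ DlvSat Pi B A := by
  have key : ∀ B, (∀ R ∈ Pi, ∀ θ : V → GTerm C, R.BodySat θ A → (tauHead θ R.head).Sat A) →
      (((tauProgram Pi).flpReduct A).Sat B ↔ DlvSat Pi B A) := fun B hA =>
    ⟨fun h R hR θ => ⟨hA R hR θ, (sat_flpReduct Pi).1 h R hR θ⟩,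
      fun h => (sat_flpReduct Pi).2 fun R hR θ => (h R hR θ).2⟩
  constructor
  · rintro ⟨h, hmin⟩
    have hA : ∀ R ∈ Pi, ∀ θ : V → GTerm C, R.BodySat θ A → (tauHead θ R.head).Sat A :=
      fun R hR θ h' => (sat_flpReduct Pi).1 h R hR θ h' h'
    exact ⟨(key A hA).1 h, fun B hB h' => hmin B hB ((key B hA).2 h')⟩
  · rintro ⟨h, hmin⟩
    have hA : ∀ R ∈ Pi, ∀ θ : V → GTerm C, R.BodySat θ A → (tauHead θ R.head).Sat A :=
      fun R hR θ => (h R hR θ).1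
    exact ⟨(key A hA).2 h, fun B hB h' => hmin B hB ((key B hA).1 h')⟩

/-! ### Ground positive rules -/

/-- A ground atom as an atom. -/
def GAtom.toPAtom (a : GAtom C) : PAtom C V := ⟨a.pred, a.args.map .gnd⟩

theorem GAtom.inst_toPAtom (a : GAtom C) (θ : V → GTerm C) : (a.toPAtom : PAtom C V).inst θ = a := by
  have : PTerm.inst θ ∘ PTerm.gnd = (id : GTerm C → GTerm C) := rfl
  simp [toPAtom, PAtom.inst, this]

/-- The ground rule with head `a` and the body consisting of the atoms `l`. -/
def posRule (a : GAtom C) (l : List (GAtom C)) : Rule C V :=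
  ⟨some a.toPAtom, l.map fun b => .basic ⟨.pos, .atom b.toPAtom⟩⟩

theorem posRule_bodySat (a : GAtom C) (l : List (GAtom C)) (θ : V → GTerm C) :
    (posRule a l).BodySat θ Y ↔ ∀ b ∈ l, b ∈ Y := by
  simp [Rule.BodySat, posRule, tauLit, tauBasic, tauNeg, tauAtomic, InfFml.Sat, GAtom.inst_toPAtom]

theorem posRule_bodyHT (a : GAtom C) (l : List (GAtom C)) (θ : V → GTerm C) :
    (posRule a l).BodyHT θ X Y ↔ ∀ b ∈ l, b ∈ Y ∧ b ∈ X := by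
  simp [Rule.BodyHT, posRule, tauLit, tauBasic, tauNeg, tauAtomic, InfFml.ht_atom,
    GAtom.inst_toPAtom]

theorem posRule_head (a : GAtom C) (l : List (GAtom C)) (θ : V → GTerm C) :
    tauHead θ (posRule a l : Rule C V).head = .atom a := by
  simp [posRule, tauHead, GAtom.inst_toPAtom]

/-- The facts `X` and the rules `p ← q` for `p` and `q` in `Y \ X`. -/
def separator (X Y : Set (GAtom C)) : Program C V :=
  {R | (∃ a ∈ X, R = posRule a []) ∨ ∃ a ∈ Y \ X, ∃ b ∈ Y \ X, R = posRule a [b]}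

/-- A positive body is satisfied by `⟨X, Y⟩` iff it is satisfied by both sets, so the FT and FLP
readings of these rules coincide. This makes the separator an admissible context. -/
theorem cliSat_separator_iff_dlvSat (S T : Set (GAtom C)) :
    CliSat (separator S T : Program C V) X Y ↔ DlvSat (separator S T : Program C V) X Y := by
  refine forall_congr' fun R => forall_congr' fun hR => forall_congr' fun θ => ?_
  obtain ⟨a, l, rfl⟩ : ∃ a l, R = posRule a l := by
    rcases hR with ⟨a, _, h⟩ | ⟨a, _, b, _, h⟩
    exacts [⟨a, [], h⟩, ⟨a, [b], h⟩]
  simp only [posRule_bodySat, posRule_bodyHT, posRule_head, InfFml.ht_atom, InfFml.Sat]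
  rw [forall₂_and]
  tauto

theorem dlvSat_separator_iff [Nonempty (V → GTerm C)] (S T : Set (GAtom C)) (hX : X ⊆ Y) :
    DlvSat (separator S T : Program C V) X Y ↔
      S ⊆ X ∧ ∀ a ∈ T \ S, ∀ b ∈ T \ S, (b ∈ Y → a ∈ Y) ∧ (b ∈ X → a ∈ X) := by
  obtain ⟨θ₀⟩ := ‹Nonempty (V → GTerm C)›
  constructor
  · intro h
    refine ⟨fun a ha => ?_, fun a ha b hb => ?_⟩
    · have := (h _ (Or.inl ⟨a, ha, rfl⟩) θ₀).2
      simpa [posRule_bodySat, posRule_head, InfFml.Sat] using this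
    · have := h _ (Or.inr ⟨a, ha, b, hb, rfl⟩) θ₀
      simp only [posRule_bodySat, posRule_head, InfFml.Sat, List.mem_singleton, forall_eq] at this
      -- `X ⊆ Y` discharges the FLP condition that the body holds in `Y`.
      exact ⟨this.1, fun h' => this.2 (hX h') h'⟩
  · rintro ⟨hS, hT⟩ R (⟨a, ha, rfl⟩ | ⟨a, ha, b, hb, rfl⟩) θ
    · simp [posRule_head, InfFml.Sat, hS ha, hX (hS ha)]
    · simp only [posRule_bodySat, posRule_head, InfFml.Sat, List.mem_singleton, forall_eq]
      exact ⟨(hT a ha b hb).1, fun _ => (hT a ha b hb).2⟩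

end Programs

/-! ### Separating two satisfaction relations -/

section Separation

variable {α : Type}

/-- `A` is `⊆`-minimal among the sets that, paired with `A`, are related by `S`. -/
def Stable (S : Set α → Set α → Prop) (A : Set α) : Prop := S A A ∧ ∀ B, B ⊂ A → ¬ S B A

/-- The relation `D` stands for the context: between `Z` and `Y` it leaves only `Z` and `Y`
themselves, since one element of `Y \ Z` forces all the others. The right `Z` depends on whether `Y`
is related to itself by `S₂`. -/
theorem separates_of_not {S₁ S₂ : Set α → Set α → Prop} {X Y : Set α} (hXY : X ⊆ Y)
    (hthere : ∀ {X Y}, S₁ X Y → S₁ Y Y) (h₁ : S₁ X Y) (h₂ : ¬ S₂ X Y) :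
    ∃ (Z : Set α), Z ⊆ Y ∧ ∀ D : Set α → Set α → Prop,
      (∀ B ⊆ Y, D B Y ↔ Z ⊆ B ∧ ∀ a ∈ Y \ Z, ∀ b ∈ Y \ Z, b ∈ B → a ∈ B) →
      ¬ (Stable (fun B A => S₁ B A ∧ D B A) Y ↔ Stable (fun B A => S₂ B A ∧ D B A) Y) := by
  have hDY : ∀ Z ⊆ Y, ∀ D : Set α → Set α → Prop,
      (∀ B ⊆ Y, D B Y ↔ Z ⊆ B ∧ ∀ a ∈ Y \ Z, ∀ b ∈ Y \ Z, b ∈ B → a ∈ B) → D Y Y :=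
    fun Z hZ D hD => (hD Y subset_rfl).2 ⟨hZ, fun a ha _ _ _ => ha.1⟩
  by_cases hY : S₂ Y Y
  -- With `Z = X` the only possible obstacle to stability of `Y` is `X`. It is an obstacle for `S₁`
  -- but not for `S₂`.
  · refine ⟨X, hXY, fun D hD h => ?_⟩
    have hne : X ≠ Y := by rintro rfl; exact h₂ hY
    refine (h.2 ⟨⟨hY, hDY X hXY D hD⟩, fun B hB hB' => ?_⟩).2 X (hXY.ssubset_of_ne hne)
      ⟨h₁, (hD X hXY).2 ⟨subset_rfl, fun _ _ b hb hb' => (hb.2 hb').elim⟩⟩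
    obtain ⟨hXB, hall⟩ := (hD B hB.subset).1 hB'.2
    by_cases hBX : B ⊆ X
    · exact h₂ (hBX.antisymm hXB ▸ hB'.1)
    · obtain ⟨b, hb, hbX⟩ := Set.not_subset.1 hBX
      refine hB.not_subset fun a ha => ?_
      by_cases haX : a ∈ X
      · exact hXB haX
      · exact hall a ⟨ha, haX⟩ b ⟨hB.subset hb, hbX⟩ hb
  -- With `Z = Y` no proper subset of `Y` survives, so stability amounts to `Y` being related to
  -- itself, which holds for `S₁` and fails for `S₂`.
  · refine ⟨Y, subset_rfl, fun D hD h => ?_⟩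
    exact hY (h.1 ⟨⟨hthere h₁, hDY Y subset_rfl D hD⟩,
      fun B hB hB' => hB.not_subset ((hD B hB.subset).1 hB'.2).1⟩).1.1

end Separation

/-! ### Dependence on variables -/

section Variables

variable {C V : Type} {θ θ' : V → GTerm C}

theorem PTerm.inst_congr {t : PTerm C V} (h : ∀ v ∈ t.vars, θ v = θ' v) : t.inst θ = t.inst θ' := by
  cases t with
  | var v => exact h v (by simp [vars])
  | gnd _ => rfl

theorem map_inst_congr {l : List (PTerm C V)} (h : ∀ v ∈ l.flatMap PTerm.vars, θ v = θ' v) :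
    l.map (PTerm.inst θ) = l.map (PTerm.inst θ') :=
  List.map_congr_left fun t ht =>
    PTerm.inst_congr fun v hv => h v (List.mem_flatMap.2 ⟨t, ht, hv⟩)

variable [LinearOrder (GTerm C)]

theorem tauBasic_congr {l : BasicLit C V} (h : ∀ v ∈ l.vars, θ v = θ' v) :
    tauBasic θ l = tauBasic θ' l := by
  obtain ⟨pre, a | ⟨t, c, u⟩⟩ := l
  · have h' : a.args.map (PTerm.inst θ) = a.args.map (PTerm.inst θ') := map_inst_congr h
    simp only [tauBasic, tauAtomic, PAtom.inst, h']
  · have h₁ : t.inst θ = t.inst θ' :=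
      PTerm.inst_congr fun v hv => h v (List.mem_append_left _ hv)
    have h₂ : u.inst θ = u.inst θ' :=
      PTerm.inst_congr fun v hv => h v (List.mem_append_right _ hv)
    classical exact congrArg (tauNeg pre) (if_congr (by rw [h₁, h₂]) rfl rfl)

variable [LinearOrder V]

theorem override_of_notMem {Z : Finset V} {y : Z → GTerm C} {v : V} (h : v ∉ Z) :
    override θ Z y v = θ v := dif_neg h

theorem mem_setSym_vars {E : AggElem C V} {Z : Finset V} {v : V} :
    v ∈ (setSym E Z).vars ↔ v ∈ E.vars ∧ v ∈ Z := by
  simp [setSym]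

/-- The instances of an aggregate element in terms of values of the local variables. -/
theorem instances_setSym (E : AggElem C V) (Z : Finset V) (θ : V → GTerm C)
    (Q : InfFml (GAtom C) → Prop) :
    instances (setSym E Z) (fun i => θ ((setSym E Z).vars.get i)) (fun η l => Q (tauBasic η l)) =
      {t | ∃ y ∈ {y : E.locals Z → GTerm C |
        ∀ l ∈ E.lits, Q (tauBasic (override θ (E.locals Z) y) l)},
        t = E.terms.map (PTerm.inst (override θ (E.locals Z) y))} := by
  ext t
  constructor
  · rintro ⟨η, hη, rfl, hQ⟩
    have hη' : ∀ v ∈ E.vars, v ∈ Z → η v = θ v := fun v hv hZ => by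
      obtain ⟨i, rfl⟩ := List.get_of_mem (mem_setSym_vars.2 ⟨hv, hZ⟩)
      exact hη i
    -- Every variable of `E` is either local or in `Z`, and on the latter `η` agrees with `θ`.
    -- Variables outside `E` are irrelevant by the congruence lemmas.
    have hov : ∀ v ∈ E.vars, η v = override θ (E.locals Z) (fun w => η w) v := fun v hv => by
      by_cases hZ : v ∈ Z
      · rw [override_of_notMem (by simp [AggElem.locals, hZ]), hη' v hv hZ]
      · have : v ∈ E.locals Z := by simp [AggElem.locals, hZ, hv]
        simp [override, this]
    refine ⟨fun w => η w, fun l hl => ?_, map_inst_congr fun v hv =>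
      hov v (List.mem_append_left _ hv)⟩
    rw [← tauBasic_congr fun v hv =>
      hov v (List.mem_append_right _ (List.mem_flatMap.2 ⟨l, hl, hv⟩))]
    exact hQ l hl
  · rintro ⟨y, hy, rfl⟩
    refine ⟨override θ (E.locals Z) y, fun i => override_of_notMem ?_, rfl, hy⟩
    have := (mem_setSym_vars.1 (List.get_mem (setSym E Z).vars i)).2
    simp only [AggElem.locals, Finset.mem_sdiff, not_and, not_not]
    exact fun _ => this

/-! ### Propositional aggregates -/

variable {X Y : Set (GAtom C)}

theorem sat_tauLits {E : AggElem C V} :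
    (tauLits θ E).Sat Y ↔ ∀ l ∈ E.lits, (tauBasic θ l).Sat Y := by
  rw [List.forall_mem_iff_get]; rfl

theorem ht_tauLits {E : AggElem C V} :
    InfFml.HT X Y (tauLits θ E) ↔ ∀ l ∈ E.lits, InfFml.HT X Y (tauBasic θ l) := by
  rw [List.forall_mem_iff_get, tauLits, InfFml.ht_conj]

/-- The conjunction over `Δ` in the translation of an aggregate atom says that the set of all
satisfied instances is not one of the sets `Δ`. -/
theorem forall_unjustified_iff {ι : Type} (J : Set ι → Prop) (L : ι → Prop) :
    (∀ Δ : {Δ : Set ι // ¬ J Δ}, (∀ y : {y // y ∈ Δ.1}, L y.1) → ∃ y : {y // y ∉ Δ.1}, L y.1) ↔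
      J {y | L y} := by
  constructor
  · intro h
    by_contra hJ
    -- Take for `Δ` the set of satisfied instances: no satisfied instance lies outside it.
    obtain ⟨y, hy⟩ := h ⟨_, hJ⟩ fun y => y.2
    exact y.2 hy
  · rintro h ⟨Δ, hΔ⟩ hall
    by_contra hex
    refine hΔ ?_
    -- If the implication for `Δ` fails, then `Δ` consists of exactly the satisfied instances.
    convert h
    exact Set.Subset.antisymm (fun y hy => hall ⟨y, hy⟩)
      fun y hy => by_contra fun hn => hex ⟨⟨y, hn⟩, hy⟩

theorem sat_tauAgg {Z : Finset V} {A : AggAtom C V} : (tauAgg Z θ A).Sat Y ↔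
    A.Justifies Z θ {y | ∀ l ∈ A.elem.lits,
      (tauBasic (override θ (A.elem.locals Z) y) l).Sat Y} := by
  simp only [← sat_tauLits]
  exact forall_unjustified_iff (A.Justifies Z θ)
    fun y => (tauLits (override θ (A.elem.locals Z) y) A.elem).Sat Y

/-- Each implication splits into a classical half at `Y` and a here-and-there half. The argument
about unjustified sets applies to each half with its own notion of satisfied instance. -/
theorem ht_tauAgg {Z : Finset V} {A : AggAtom C V} : InfFml.HT X Y (tauAgg Z θ A) ↔
    (tauAgg Z θ A).Sat Y ∧ A.Justifies Z θ {y | ∀ l ∈ A.elem.lits,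
      InfFml.HT X Y (tauBasic (override θ (A.elem.locals Z) y) l)} := by
  simp only [← ht_tauLits]
  rw [← forall_unjustified_iff (A.Justifies Z θ)]
  simp only [tauAgg, InfFml.ht_conj, InfFml.ht_imp, InfFml.ht_disj, InfFml.Sat, forall_and]

theorem justifies_iff {Z : Finset V} {A : AggAtom C V} {Q : InfFml (GAtom C) → Prop} :
    A.Justifies Z θ {y | ∀ l ∈ A.elem.lits, Q (tauBasic (override θ (A.elem.locals Z) y) l)} ↔
      A.cmp.Holds (A.op.hat (instances (setSym A.elem Z)
        (fun i => θ ((setSym A.elem Z).vars.get i)) (fun η l => Q (tauBasic η l))))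
        (A.guard.inst θ) := by
  rw [instances_setSym]
  rfl

end Variables

/-! ### First-order translations in standard interpretations -/

section Translation

variable {C V : Type} [LinearOrder (GTerm C)] {g : ProgSig C V} {U : Set (Set (Tup g))}
  {H I : TInterp g U} {X Y : Set (GAtom C)} {θ : V → GTerm C}

/-- The predicate symbols of the signature are interpreted in accordance with the set `Y`. -/
def Agrees (I : TInterp g U) (Y : Set (GAtom C)) : Prop :=
  ∀ (p : PredSym C) (hp : p ∈ g.P) (a : Fin p.2 → GTerm C),
    I.pr (TPr.pred p hp) a ↔ (⟨p.1, List.ofFn a⟩ : GAtom C) ∈ Y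

theorem eval_trTerm (hI : IsStandard I) (t : PTerm C V) :
    (trTerm t : TTerm g).eval I (valOf θ) = t.inst θ := by
  cases t with
  | var v => rfl
  | gnd t => exact hI.obj t _

theorem sat_trCmp (hI : IsStandard I) (c : CmpSym) (t u : TTerm g)
    (ν : Valuation (σ := g.sig) (TVar V) (StdDom g U)) :
    (trCmp c t u).Sat I ν ↔ c.Holds (C := C) (t.eval I ν) (u.eval I ν) := by
  cases c with
  | eq => rfl
  | rel r => exact hI.cmp r _

theorem htSat_trCmp (c : CmpSym) (t u : TTerm g)
    (ν : Valuation (σ := g.sig) (TVar V) (StdDom g U)) :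
    (trCmp c t u).HTSat H I ν ↔ (trCmp c t u).Sat I ν ∧ (trCmp c t u).Sat H ν := by
  cases c <;> rfl

theorem sat_trAtom (hI : IsStandard I) (hY : Agrees I Y) {a : PAtom C V} (ha : a.sym ∈ g.P) :
    (trAtom a : TFml g).Sat I (valOf θ) ↔ a.inst θ ∈ Y := by
  rw [trAtom, dif_pos ha]
  refine (hY a.sym ha _).trans (iff_of_eq ?_)
  congr 1
  simp only [PAtom.inst, PAtom.sym, GAtom.mk.injEq, true_and]
  apply List.ext_get
  · simp
  · intro n h₁ h₂
    simp [eval_trTerm hI]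

theorem htSat_trAtom (a : PAtom C V) (ν : Valuation (σ := g.sig) (TVar V) (StdDom g U)) :
    (trAtom a : TFml g).HTSat H I ν ↔
      (trAtom a : TFml g).Sat I ν ∧ (trAtom a : TFml g).Sat H ν := by
  rw [trAtom]
  split
  · rfl
  · exact ⟨False.elim, fun h => h.1⟩

theorem sat_trNeg (x : Sem) (pre : NegPrefix) {F : TFml g} {G : InfFml (GAtom C)}
    {ν : Valuation (σ := g.sig) (TVar V) (StdDom g U)} (h : F.Sat I ν ↔ G.Sat Y) :
    (trNeg x pre F).Sat I ν ↔ (tauNeg pre G).Sat Y := by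
  cases pre <;> cases x <;>
    simp [trNeg, tauNeg, Fml.neg, Fml.Sat, InfFml.sat_neg, h]

theorem htSat_trNeg_cli (pre : NegPrefix) {F : TFml g} {G : InfFml (GAtom C)}
    {ν : Valuation (σ := g.sig) (TVar V) (StdDom g U)} (h : F.Sat I ν ↔ G.Sat Y)
    (h' : F.HTSat H I ν ↔ InfFml.HT X Y G) :
    (trNeg .cli pre F).HTSat H I ν ↔ InfFml.HT X Y (tauNeg pre G) := by
  cases pre <;>
    simp [trNeg, tauNeg, Fml.neg, Fml.Sat, Fml.HTSat, InfFml.sat_neg, InfFml.ht_neg, h, h']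

/-- Unlike `¬`, the connective `sneg` preserves the property that here-and-there satisfaction is
satisfaction in both worlds separately. This is the source of the FLP behaviour. -/
theorem htSat_trNeg_dlv (pre : NegPrefix) {F : TFml g}
    {ν : Valuation (σ := g.sig) (TVar V) (StdDom g U)}
    (h : F.HTSat H I ν ↔ F.Sat I ν ∧ F.Sat H ν) :
    (trNeg .dlv pre F).HTSat H I ν ↔
      (trNeg .dlv pre F).Sat I ν ∧ (trNeg .dlv pre F).Sat H ν := by
  cases pre <;> simp [trNeg, Fml.Sat, Fml.HTSat, h]

theorem sat_trAtomic (hI : IsStandard I) (hY : Agrees I Y) {F : AtomicFormula C V}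
    (hF : F.preds ⊆ g.P) : (trAtomic F : TFml g).Sat I (valOf θ) ↔ (tauAtomic θ F).Sat Y := by
  cases F with
  | atom a => exact sat_trAtom hI hY (hF rfl)
  | cmp t c u =>
    simp only [trAtomic, tauAtomic]
    rw [sat_trCmp hI, eval_trTerm hI, eval_trTerm hI]
    split <;> rename_i h
    · simp [h, InfFml.sat_top]
    · simp [h, InfFml.sat_bot]

theorem htSat_trAtomic (F : AtomicFormula C V)
    (ν : Valuation (σ := g.sig) (TVar V) (StdDom g U)) :
    (trAtomic F : TFml g).HTSat H I ν ↔
      (trAtomic F : TFml g).Sat I ν ∧ (trAtomic F : TFml g).Sat H ν := by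
  cases F with
  | atom a => exact htSat_trAtom a ν
  | cmp t c u => exact htSat_trCmp c _ _ ν

theorem ht_tauAtomic (F : AtomicFormula C V) :
    InfFml.HT X Y (tauAtomic θ F) ↔ (tauAtomic θ F).Sat Y ∧ (tauAtomic θ F).Sat X := by
  cases F with
  | atom a => exact InfFml.ht_atom _
  | cmp t c u =>
    simp only [tauAtomic]
    split
    · simp [InfFml.sat_top, InfFml.ht_top]
    · simp [InfFml.sat_bot, InfFml.ht_bot]

theorem sat_trBasic (hI : IsStandard I) (hY : Agrees I Y) (x : Sem) {l : BasicLit C V}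
    (hl : l.body.preds ⊆ g.P) :
    (trBasic x l : TFml g).Sat I (valOf θ) ↔ (tauBasic θ l).Sat Y :=
  sat_trNeg x _ (sat_trAtomic hI hY hl)

theorem htSat_trBasic_cli (hH : IsStandard H) (hI : IsStandard I) (hX : Agrees H X)
    (hY : Agrees I Y) {l : BasicLit C V} (hl : l.body.preds ⊆ g.P) :
    (trBasic .cli l : TFml g).HTSat H I (valOf θ) ↔ InfFml.HT X Y (tauBasic θ l) := by
  refine htSat_trNeg_cli _ (sat_trAtomic hI hY hl) ?_
  rw [htSat_trAtomic, ht_tauAtomic, sat_trAtomic hI hY hl, sat_trAtomic hH hX hl]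

theorem instances_congr {e : SetSym C V} {a : Fin e.vars.length → GTerm C}
    {Q Q' : (V → GTerm C) → BasicLit C V → Prop}
    (h : ∀ θ, ∀ l ∈ e.elem.lits, (Q θ l ↔ Q' θ l)) : instances e a Q = instances e a Q' := by
  ext t
  refine exists_congr fun θ => and_congr_right fun _ => and_congr_right fun _ => ?_
  exact forall₂_congr (h θ)

theorem preds_of_mem_lits {e : SetSym C V} (he : e ∈ g.S) {l : BasicLit C V}
    (hl : l ∈ e.elem.lits) : l.body.preds ⊆ g.P :=
  fun _ hp => g.closed e he ⟨l, hl, hp⟩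

/-! ### Rules -/

variable [LinearOrder V]

/-- The parameter `Q` allows one argument to serve all three ways of evaluating an element: in `Y`,
in `X`, and in the pair `⟨X, Y⟩`. -/
theorem sat_trAgg (hI : IsStandard I) (x : Sem) {Z : Finset V} {A : AggAtom C V}
    (hA : setSym A.elem Z ∈ g.S) {Q : InfFml (GAtom C) → Prop}
    (hs : ∀ a, setVal I x (setSym A.elem Z) hA a =
      instances (setSym A.elem Z) a fun η l => Q (tauBasic η l)) :
    (trAgg x Z A : TFml g).Sat I (valOf θ) ↔ A.Justifies Z θ
      {y | ∀ l ∈ A.elem.lits, Q (tauBasic (override θ (A.elem.locals Z) y) l)} := by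
  rw [trAgg, dif_pos hA, sat_trCmp hI, eval_trTerm hI, justifies_iff, ← hs]
  refine iff_of_eq (congrArg (fun s => A.cmp.Holds s _) ?_)
  exact hI.op A.op _

theorem htSat_trAgg (x : Sem) (Z : Finset V) (A : AggAtom C V)
    (ν : Valuation (σ := g.sig) (TVar V) (StdDom g U)) :
    (trAgg x Z A : TFml g).HTSat H I ν ↔
      (trAgg x Z A : TFml g).Sat I ν ∧ (trAgg x Z A : TFml g).Sat H ν := by
  rw [trAgg]
  split
  · exact htSat_trCmp _ _ _ ν
  · exact ⟨False.elim, fun h => h.1⟩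

/-- The symbols of a body literal belong to the signature. -/
def Lit.Covered (g : ProgSig C V) (Z : Finset V) (B : Lit C V) : Prop :=
  B.preds ⊆ g.P ∧ ∀ pre A, B = .agg pre A → setSym A.elem Z ∈ g.S

theorem sat_trAgg_there (hI : IsAggInterp I) (hY : Agrees I Y) (x : Sem) {Z : Finset V}
    {A : AggAtom C V} (hA : setSym A.elem Z ∈ g.S) :
    (trAgg x Z A : TFml g).Sat I (valOf θ) ↔ (tauAgg Z θ A).Sat Y := by
  rw [sat_tauAgg]
  refine sat_trAgg (Q := fun F => F.Sat Y) hI.standard x hA fun a => ?_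
  rw [hI.sets]
  exact instances_congr fun η l hl => sat_trBasic hI.standard hY x (preds_of_mem_lits hA hl)

theorem sat_trAgg_here_dlv (hHI : IsAggHTInterp H I) (hX : Agrees H X) {Z : Finset V}
    {A : AggAtom C V} (hA : setSym A.elem Z ∈ g.S) :
    (trAgg .dlv Z A : TFml g).Sat H (valOf θ) ↔ (tauAgg Z θ A).Sat X := by
  rw [sat_tauAgg]
  refine sat_trAgg (Q := fun F => F.Sat X) hHI.here .dlv hA fun a => ?_
  rw [hHI.dlv]
  exact instances_congr fun η l hl => sat_trBasic hHI.here hX .dlv (preds_of_mem_lits hA hl)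

/-- The translated atom is evaluated in each world separately, but in `H` the clingo set function
collects the instances satisfied by `⟨H, I⟩`. These are the instances that the FT-reduct of the
infinitary formula counts. -/
theorem htSat_trAgg_cli (hHI : IsAggHTInterp H I) (hX : Agrees H X) (hY : Agrees I Y)
    {Z : Finset V} {A : AggAtom C V} (hA : setSym A.elem Z ∈ g.S) :
    (trAgg .cli Z A : TFml g).HTSat H I (valOf θ) ↔ InfFml.HT X Y (tauAgg Z θ A) := by
  rw [htSat_trAgg, ht_tauAgg, sat_trAgg_there hHI.there hY .cli hA]
  refine and_congr_right fun _ => sat_trAgg (Q := InfFml.HT X Y) hHI.here .cli hA fun a => ?_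
  rw [hHI.cli]
  exact instances_congr fun η l hl =>
    htSat_trBasic_cli hHI.here hHI.there.standard hX hY (preds_of_mem_lits hA hl)

theorem sat_trLit_there (hI : IsAggInterp I) (hY : Agrees I Y) (x : Sem) {Z : Finset V}
    {B : Lit C V} (hB : B.Covered g Z) :
    (trLit x Z B : TFml g).Sat I (valOf θ) ↔ (tauLit Z θ B).Sat Y := by
  cases B with
  | basic l => exact sat_trBasic hI.standard hY x hB.1
  | agg pre A => exact sat_trNeg x pre (sat_trAgg_there hI hY x (hB.2 pre A rfl))

theorem htSat_trLit_cli (hHI : IsAggHTInterp H I) (hX : Agrees H X) (hY : Agrees I Y)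
    {Z : Finset V} {B : Lit C V} (hB : B.Covered g Z) :
    (trLit .cli Z B : TFml g).HTSat H I (valOf θ) ↔ InfFml.HT X Y (tauLit Z θ B) := by
  cases B with
  | basic l => exact htSat_trBasic_cli hHI.here hHI.there.standard hX hY hB.1
  | agg pre A =>
    have hA := hB.2 pre A rfl
    exact htSat_trNeg_cli pre (sat_trAgg_there hHI.there hY .cli hA)
      (htSat_trAgg_cli hHI hX hY hA)

theorem htSat_trLit_dlv (hHI : IsAggHTInterp H I) (hX : Agrees H X) (hY : Agrees I Y)
    {Z : Finset V} {B : Lit C V} (hB : B.Covered g Z) :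
    (trLit .dlv Z B : TFml g).HTSat H I (valOf θ) ↔
      (tauLit Z θ B).Sat Y ∧ (tauLit Z θ B).Sat X := by
  rw [← sat_trLit_there hHI.there hY .dlv hB]
  cases B with
  | basic l =>
    refine (htSat_trNeg_dlv _ (htSat_trAtomic _ _)).trans (and_congr_right fun _ => ?_)
    exact sat_trBasic hHI.here hX .dlv hB.1
  | agg pre A =>
    refine (htSat_trNeg_dlv _ (htSat_trAgg _ _ _ _)).trans (and_congr_right fun _ => ?_)
    exact sat_trNeg .dlv pre (sat_trAgg_here_dlv hHI hX (hB.2 pre A rfl))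

theorem sat_conj (l : List (TFml g)) (ν : Valuation (σ := g.sig) (TVar V) (StdDom g U)) :
    (Fml.conj l).Sat I ν ↔ ∀ F ∈ l, F.Sat I ν := by
  induction l with
  | nil => simp [Fml.conj, Fml.top, Fml.Sat]
  | cons F l ih =>
    rw [List.forall_mem_cons, ← ih]
    rfl

theorem htSat_conj (l : List (TFml g)) (ν : Valuation (σ := g.sig) (TVar V) (StdDom g U)) :
    (Fml.conj l).HTSat H I ν ↔ ∀ F ∈ l, F.HTSat H I ν := by
  induction l with
  | nil => simp [Fml.conj, Fml.top, Fml.Sat, Fml.HTSat]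
  | cons F l ih =>
    rw [List.forall_mem_cons, ← ih]
    rfl

theorem Valuation.upd_self (ν : Valuation (σ := g.sig) (TVar V) (StdDom g U)) (v : V) :
    ν.upd (s := TSort.gen) v (ν ⟨TSort.gen, v⟩) = ν :=
  @Function.update_eq_self _ _ (Classical.decEq _) _ _

/-- Under quantification over all valuations the universal closure is redundant; updating a variable
by its own value removes a quantifier. -/
theorem forall_htSat_closure (l : List V) (F : TFml g) :
    (∀ ν, (l.foldr (fun v F => Fml.all (σ := g.sig) (s := TSort.gen) v F) F).HTSat H I ν) ↔
      ∀ ν, F.HTSat H I ν := by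
  induction l with
  | nil => rfl
  | cons v l ih =>
    rw [← ih]
    refine ⟨fun h ν => ?_, fun h ν d => h _⟩
    have := h ν (ν ⟨TSort.gen, v⟩)
    rwa [Valuation.upd_self] at this

theorem forall_valuation {p : Valuation (σ := g.sig) (TVar V) (StdDom g U) → Prop} :
    (∀ ν, p ν) ↔ ∀ θ : V → GTerm C, p (valOf θ) := by
  refine ⟨fun h θ => h _, fun h ν => ?_⟩
  convert h fun v => ν ⟨TSort.gen, v⟩
  funext x
  obtain ⟨_ | _ | _, v⟩ := x
  · rfl
  · exact Empty.elim v
  · exact Empty.elim v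

theorem htModels_trProgram_iff (x : Sem) (Pi : Program C V) :
    HTModels H I (trProgram g x Pi) ↔ ∀ R ∈ Pi, ∀ θ : V → GTerm C,
      ((∀ B ∈ R.body, (trLit x R.globals B : TFml g).Sat I (valOf θ)) →
        (trHead R.head : TFml g).Sat I (valOf θ)) ∧
      ((∀ B ∈ R.body, (trLit x R.globals B : TFml g).HTSat H I (valOf θ)) →
        (trHead R.head : TFml g).HTSat H I (valOf θ)) := by
  have : HTModels H I (trProgram g x Pi) ↔ ∀ R ∈ Pi, ∀ ν, (trRule x R : TFml g).HTSat H I ν :=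
    ⟨fun h R hR => h _ ⟨R, hR, rfl⟩, by rintro h _ ⟨R, hR, rfl⟩; exact h R hR⟩
  rw [this]
  refine forall₂_congr fun R _ => ?_
  rw [trRule, forall_htSat_closure, forall_valuation]
  refine forall_congr' fun θ => ?_
  simp only [Fml.HTSat, Fml.Sat, sat_conj, htSat_conj, List.forall_mem_map, ← imp_iff_not_or]

theorem sat_trHead (hI : IsStandard I) (hY : Agrees I Y) {h : Option (PAtom C V)}
    (hh : ∀ a ∈ h, a.sym ∈ g.P) :
    (trHead h : TFml g).Sat I (valOf θ) ↔ (tauHead θ h).Sat Y := by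
  cases h with
  | none => exact ⟨False.elim, fun h => InfFml.sat_bot h⟩
  | some a => exact sat_trAtom hI hY (hh a rfl)

theorem htSat_trHead (h : Option (PAtom C V))
    (ν : Valuation (σ := g.sig) (TVar V) (StdDom g U)) :
    (trHead h : TFml g).HTSat H I ν ↔
      (trHead h : TFml g).Sat I ν ∧ (trHead h : TFml g).Sat H ν := by
  cases h with
  | none => exact ⟨False.elim, fun h => h.1⟩
  | some a => exact htSat_trAtom a ν

theorem ht_tauHead (h : Option (PAtom C V)) :
    InfFml.HT X Y (tauHead θ h) ↔ (tauHead θ h).Sat Y ∧ (tauHead θ h).Sat X := by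
  cases h with
  | none => exact ⟨fun h => (InfFml.ht_bot h).elim, fun h => (InfFml.sat_bot h.1).elim⟩
  | some a => exact InfFml.ht_atom _

theorem ProgSig.Covers.lit {Pi : Program C V} (hg : g.Covers Pi) {R : Rule C V} (hR : R ∈ Pi)
    {B : Lit C V} (hB : B ∈ R.body) : B.Covered g R.globals :=
  ⟨fun _ hp => hg.1 ⟨R, hR, Or.inr ⟨B, hB, hp⟩⟩,
    fun pre A h => hg.2 ⟨R, hR, pre, A, h ▸ hB, rfl⟩⟩

theorem ProgSig.Covers.head {Pi : Program C V} (hg : g.Covers Pi) {R : Rule C V} (hR : R ∈ Pi) :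
    ∀ a ∈ R.head, a.sym ∈ g.P :=
  fun a ha => hg.1 ⟨R, hR, Or.inl ⟨a, ha, rfl⟩⟩

theorem htModels_cli_iff {Pi : Program C V} (hg : g.Covers Pi) (hHI : IsAggHTInterp H I)
    (hX : Agrees H X) (hY : Agrees I Y) :
    HTModels H I (trProgram g .cli Pi) ↔ CliSat Pi X Y := by
  rw [htModels_trProgram_iff]
  refine forall₂_congr fun R hR => forall_congr' fun θ => ?_
  rw [htSat_trHead, ht_tauHead, sat_trHead hHI.there.standard hY (hg.head hR),
    sat_trHead hHI.here hX (hg.head hR)]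
  refine and_congr (imp_congr_left ?_) (imp_congr_left ?_)
  · exact forall₂_congr fun B hB => sat_trLit_there hHI.there hY .cli (hg.lit hR hB)
  · exact forall₂_congr fun B hB => htSat_trLit_cli hHI hX hY (hg.lit hR hB)

theorem htModels_dlv_iff {Pi : Program C V} (hg : g.Covers Pi) (hHI : IsAggHTInterp H I)
    (hX : Agrees H X) (hY : Agrees I Y) :
    HTModels H I (trProgram g .dlv Pi) ↔ DlvSat Pi X Y := by
  rw [htModels_trProgram_iff]
  refine forall₂_congr fun R hR => forall_congr' fun θ => ?_
  rw [htSat_trHead, sat_trHead hHI.there.standard hY (hg.head hR),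
    sat_trHead hHI.here hX (hg.head hR)]
  have hI : (∀ B ∈ R.body, (trLit .dlv R.globals B : TFml g).Sat I (valOf θ)) ↔ R.BodySat θ Y :=
    forall₂_congr fun B hB => sat_trLit_there hHI.there hY .dlv (hg.lit hR hB)
  have hHT : (∀ B ∈ R.body, (trLit .dlv R.globals B : TFml g).HTSat H I (valOf θ)) ↔
      R.BodySat θ Y ∧ R.BodySat θ X := by
    rw [Rule.BodySat, Rule.BodySat, ← forall₂_and]
    exact forall₂_congr fun B hB => htSat_trLit_dlv hHI hX hY (hg.lit hR hB)
  rw [hI, hHT]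
  tauto

end Translation

/-! ### Existence of agg-ht-interpretations -/

section Existence

variable {C V : Type} [LinearOrder (GTerm C)]

/-- The standard interpretation with the set universe consisting of all sets of tuples, in which
atoms are interpreted by `X` and `s^x_{E/X}` by the instances that satisfy `Q x`. -/
noncomputable def stdInterp (g : ProgSig C V) (X : Set (GAtom C)) (Q : Sem → InfFml (GAtom C) → Prop) :
    TInterp g Set.univ where
  fn
    | .obj t => fun _ => t
    | .tuple _ hk => fun a => ⟨List.ofFn a, by simpa using hk⟩
    | .op o => fun a => o.hat (tuplesOf (g := g) (U := Set.univ) (a (0 : Fin 1)))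
    | .setFn x e _ => fun a => ⟨{u | u.1 ∈ instances e a fun θ l => Q x (tauBasic θ l)}, trivial⟩
  pr
    | .pred p _ => fun a => (⟨p.1, List.ofFn a⟩ : GAtom C) ∈ X
    | .cmp r => fun a => r.Holds (C := C) (a (0 : Fin 2)) (a (1 : Fin 2))
    | .mem => fun a => (show Tup g from a (0 : Fin 2)) ∈
        (show (Set.univ : Set (Set (Tup g))) from a (1 : Fin 2)).1

variable {g : ProgSig C V} {X Y : Set (GAtom C)}

theorem isStandard_stdInterp (Q : Sem → InfFml (GAtom C) → Prop) :
    IsStandard (stdInterp g X Q) where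
  obj _ _ := rfl
  cmp _ _ := Iff.rfl
  tuple _ _ _ := rfl
  mem _ := Iff.rfl
  op _ _ := rfl

theorem agrees_stdInterp (Q : Sem → InfFml (GAtom C) → Prop) : Agrees (stdInterp g X Q) X :=
  fun _ _ _ => Iff.rfl

/-- Nothing is lost by restricting to the tuple universe: an instance of `e` has the length of the
term list of `e`, which is one of the lengths allowed. -/
theorem setVal_stdInterp (Q : Sem → InfFml (GAtom C) → Prop) (x : Sem) (e : SetSym C V)
    (he : e ∈ g.S) (a : Fin e.vars.length → GTerm C) :
    setVal (stdInterp g X Q) x e he a = instances e a fun θ l => Q x (tauBasic θ l) := by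
  ext t
  constructor
  · rintro ⟨u, hu, rfl⟩
    exact hu
  · intro ht
    have ht' := ht
    obtain ⟨θ, _, rfl, _⟩ := ht'
    exact ⟨⟨_, e, he, by simp⟩, ht, rfl⟩

/-- The conditions on set functions are not circular, because basic literals mention only predicates
and comparisons. The set values can therefore be read off from `X` and `Y` in advance. -/
theorem exists_isAggHTInterp (g : ProgSig C V) (hXY : X ⊆ Y) :
    ∃ H I : TInterp g Set.univ, IsAggHTInterp H I ∧ Agrees H X ∧ Agrees I Y := by
  let QH : Sem → InfFml (GAtom C) → Prop := fun
    | .cli => InfFml.HT X Y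
    | .dlv => InfFml.Sat X
  refine ⟨stdInterp g X QH, stdInterp g Y fun _ => InfFml.Sat Y, ?_, agrees_stdInterp _,
    agrees_stdInterp _⟩
  refine ⟨⟨?_, ?_, ?_⟩, isStandard_stdInterp _, ⟨isStandard_stdInterp _, ?_⟩, ?_, ?_⟩
  · rintro _ ⟨p, hp, rfl⟩ a h
    exact hXY h
  · rintro (⟨p, hp⟩ | r | _) h
    · exact (h ⟨p, hp, rfl⟩).elim
    · rfl
    · rfl
  · rintro (t | ⟨k, hk⟩ | o | ⟨x, e, he⟩) h
    · rfl
    · rfl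
    · rfl
    · exact (h ⟨x, e, he, rfl⟩).elim
  · intro x e he a
    rw [setVal_stdInterp]
    exact instances_congr fun θ l hl => (sat_trBasic (isStandard_stdInterp _)
      (agrees_stdInterp _) x (preds_of_mem_lits he hl)).symm
  · intro e he a
    rw [setVal_stdInterp]
    exact instances_congr fun θ l hl => (htSat_trBasic_cli (isStandard_stdInterp _)
      (isStandard_stdInterp _) (agrees_stdInterp _) (agrees_stdInterp _)
      (preds_of_mem_lits he hl)).symm
  · intro e he a
    rw [setVal_stdInterp]
    exact instances_congr fun θ l hl => (sat_trBasic (isStandard_stdInterp _)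
      (agrees_stdInterp _) .dlv (preds_of_mem_lits he hl)).symm

/-- The ground atoms satisfied by an interpretation. -/
def atomsOf {U : Set (Set (Tup g))} (I : TInterp g U) : Set (GAtom C) :=
  {b | ∃ h : (b.pred, b.args.length) ∈ g.P, I.pr (TPr.pred (b.pred, b.args.length) h) b.args.get}

theorem agrees_atomsOf {U : Set (Set (Tup g))} (I : TInterp g U) : Agrees I (atomsOf I) := by
  rintro ⟨c, n⟩ hp a
  change Fin n → GTerm C at a
  -- The arity recovered from the list equals `n` only propositionally, so the length is generalized
  -- in order to transport the arguments.
  have key : ∀ (m : ℕ) (b : Fin m → GTerm C) (hm : (c, m) ∈ g.P) (hmn : m = n),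
      (∀ i, b i = a (Fin.cast hmn i)) →
      (I.pr (TPr.pred (c, m) hm) b ↔ I.pr (TPr.pred (c, n) hp) a) := by
    rintro m b hm rfl hb
    obtain rfl : b = a := funext hb
    rfl
  have hlen : (List.ofFn a).length = n := List.length_ofFn
  have hP : (c, (List.ofFn a).length) ∈ g.P := by rwa [hlen]
  have := key (List.ofFn a).length (List.ofFn a).get hP hlen (fun i => by rw [List.get_ofFn])
  exact ⟨fun h => ⟨hP, this.2 h⟩, fun ⟨_, h⟩ => this.1 h⟩

theorem atomsOf_subset {U : Set (Set (Tup g))} {H I : TInterp g U}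
    (h : Interp.Below g.intPr g.intFn H I) : atomsOf H ⊆ atomsOf I :=
  fun _ ⟨hP, hb⟩ => ⟨hP, h.pr_subset _ ⟨_, hP, rfl⟩ _ hb⟩

/-! ### Both conditions of the theorem in terms of pairs of sets of atoms. -/

variable [LinearOrder V]

/-- Having the same agg-ht-models does not depend on the signature and can be expressed by pairs
of sets of ground atoms. -/
theorem sameAggHTModels_iff {Pi₁ Pi₂ : Program C V} (h₁ : g.Covers Pi₁) (h₂ : g.Covers Pi₂) :
    SameAggHTModels (trProgram g .cli Pi₁) (trProgram g .dlv Pi₂) ↔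
      ∀ X Y : Set (GAtom C), X ⊆ Y → (CliSat Pi₁ X Y ↔ DlvSat Pi₂ X Y) := by
  constructor
  · intro h X Y hXY
    -- The full power set as set universe suffices to realize every pair; the converse has to treat
    -- an arbitrary universe `U`.
    obtain ⟨H, I, hHI, hX, hY⟩ := exists_isAggHTInterp g hXY
    rw [← htModels_cli_iff h₁ hHI hX hY, ← htModels_dlv_iff h₂ hHI hX hY]
    exact h _ H I hHI
  · intro h U H I hHI
    rw [htModels_cli_iff h₁ hHI (agrees_atomsOf H) (agrees_atomsOf I),
      htModels_dlv_iff h₂ hHI (agrees_atomsOf H) (agrees_atomsOf I)]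
    exact h _ _ (atomsOf_subset hHI.below)

theorem ProgSig.covers_extend (g : ProgSig C V) (Delta : Program C V) :
    (g.extend Delta).Covers Delta :=
  ⟨Set.subset_union_right, Set.subset_union_right⟩

theorem isClingoAnswerSet_union_iff {Pi Delta : Program C V} {A : Set (GAtom C)} :
    IsClingoAnswerSet (Pi ∪ Delta) A ↔
      Stable (fun X Y => CliSat Pi X Y ∧ CliSat Delta X Y) A := by
  simp only [isClingoAnswerSet_iff, cliSat_union, Stable]

theorem isDlvAnswerSet_union_iff {Pi Delta : Program C V} {A : Set (GAtom C)} :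
    IsDlvAnswerSet (Pi ∪ Delta) A ↔
      Stable (fun X Y => DlvSat Pi X Y ∧ DlvSat Delta X Y) A := by
  simp only [isDlvAnswerSet_iff, dlvSat_union, Stable]

theorem stable_congr {α : Type} {S T : Set α → Set α → Prop}
    (h : ∀ X Y, X ⊆ Y → (S X Y ↔ T X Y)) (A : Set α) : Stable S A ↔ Stable T A :=
  and_congr (h A A subset_rfl) (forall₂_congr fun B hB => not_congr (h B A hB.subset))

end Existence

end AggASP

theorem mainTheorem5 {C V : Type} [Countable C] [Infinite C] [Countable V] [Infinite V]
    [LinearOrder V] [LinearOrder (AggASP.GTerm C)] (hord : AggASP.IsTermOrder C)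
    (Pi₁ Pi₂ : AggASP.Program C V) (g : AggASP.ProgSig C V) (hg : g.Covers (Pi₁ ∪ Pi₂)) :
    AggASP.SameAggHTModels (AggASP.trProgram g .cli Pi₁) (AggASP.trProgram g .dlv Pi₂) ↔
      ∀ Delta : AggASP.Program C V,
        AggASP.SameAggHTModels (AggASP.trProgram (g.extend Delta) .cli Delta)
          (AggASP.trProgram (g.extend Delta) .dlv Delta) →
        {A | AggASP.IsClingoAnswerSet (Pi₁ ∪ Delta) A} =
          {A | AggASP.IsDlvAnswerSet (Pi₂ ∪ Delta) A} := by
  open AggASP in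
  have h₁ : g.Covers Pi₁ := ⟨fun p ⟨R, hR, hp⟩ => hg.1 ⟨R, Or.inl hR, hp⟩,
    fun e ⟨R, hR, he⟩ => hg.2 ⟨R, Or.inl hR, he⟩⟩
  have h₂ : g.Covers Pi₂ := ⟨fun p ⟨R, hR, hp⟩ => hg.1 ⟨R, Or.inr hR, hp⟩,
    fun e ⟨R, hR, he⟩ => hg.2 ⟨R, Or.inr hR, he⟩⟩
  rw [sameAggHTModels_iff h₁ h₂]
  constructor
  · intro h Delta hDelta
    rw [sameAggHTModels_iff (g.covers_extend Delta) (g.covers_extend Delta)] at hDelta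
    ext A
    simp only [Set.mem_ofPred_eq, isClingoAnswerSet_union_iff, isDlvAnswerSet_union_iff]
    exact stable_congr (fun X Y hXY => and_congr (h X Y hXY) (hDelta X Y hXY)) A
  · intro h X Y hXY
    have : Nonempty (V → GTerm C) := ⟨fun _ => GTerm.inf⟩
    have hstable : ∀ Z : Set (GAtom C),
        Stable (fun B A => CliSat Pi₁ B A ∧ DlvSat (separator Z Y : Program C V) B A) Y ↔
        Stable (fun B A => DlvSat Pi₂ B A ∧ DlvSat (separator Z Y : Program C V) B A) Y := by
      intro Z
      -- The separator is admissible as a context, and both of its readings can be written as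
      -- `DlvSat`, so the two programs are combined with one and the same relation.
      have := h (separator Z Y) ((sameAggHTModels_iff (g.covers_extend _) (g.covers_extend _)).2
        fun X Y _ => cliSat_separator_iff_dlvSat Z _)
      have := Set.ext_iff.1 this Y
      simpa only [Set.mem_ofPred_eq, isClingoAnswerSet_union_iff, isDlvAnswerSet_union_iff,
        cliSat_separator_iff_dlvSat] using this
    have hsep : ∀ Z : Set (GAtom C), ∀ B ⊆ Y, DlvSat (separator Z Y : Program C V) B Y ↔
        Z ⊆ B ∧ ∀ a ∈ Y \ Z, ∀ b ∈ Y \ Z, b ∈ B → a ∈ B := by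
      intro Z B hB
      rw [dlvSat_separator_iff Z Y hB]
      refine and_congr_right fun _ => forall₂_congr fun a ha => forall₂_congr fun b _ => ?_
      -- The requirement on the second component is automatic, because `Y` contains every head from
      -- `Y \ Z`.
      exact and_iff_right fun _ => ha.1
    by_contra hne
    have hne' := not_iff.1 hne
    -- The pair belongs to exactly one of the two relations. That relation takes the role of `S₁` in
    -- the separation, which needs only that it passes from `(X, Y)` to `(Y, Y)`.
    by_cases hc : CliSat Pi₁ X Y
    · obtain ⟨Z, _, hZ⟩ := separates_of_not (S₁ := CliSat Pi₁) (S₂ := DlvSat Pi₂) hXY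
        CliSat.there hc fun hd => hne (iff_of_true hc hd)
      exact hZ _ (hsep Z) (hstable Z)
    · obtain ⟨Z, _, hZ⟩ := separates_of_not (S₁ := DlvSat Pi₂) (S₂ := CliSat Pi₁) hXY
        DlvSat.there (hne'.1 hc) hc
      exact hZ _ (hsep Z) (hstable Z).symm
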